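/- Let $t\ge 9$ be an integer, and let $D(1,t)$ be the distance graph with vertex set $\mathbb{Z}$ in which two distinct integers $i,j$ are adjacent if and only if $|i-j|\in\{1,t\}$. For a graph $G$, a packing $k$-coloring is a partition of the vertex set of $G$ into classes $X_1,\dots,X_k$ (some possibly empty) such that, for each $i$, any two distinct vertices of $X_i$ are at distance greater than $i$ in $G$; the packing chromatic number $\chi_\rho(G)$ is the smallest $k$ for which $G$ has a packing $k$-coloring ($\infty$ if there is none). Then $$\chi_\rho(D(1,t))\ \ge\ 12 .$$ -/

import Mathlib

/-- The set `X` of vertices is an `i`-packing of `G`: any two distinct vertices of `X` are at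
distance greater than `i`. The distance takes values in `ℕ∞`, and is infinite between different
components. -/
def IsPacking {V : Type*} (G : SimpleGraph V) (i : ℕ) (X : Set V) : Prop :=
  ∀ u ∈ X, ∀ v ∈ X, u ≠ v → (i : ℕ∞) < G.edist u v

/-- `c` is a packing `k`-coloring of `G`: its colors are among `1, …, k`, and for each color `i`
the class of color `i` (which may be empty) is an `i`-packing. -/
def IsPackingColoring {V : Type*} (G : SimpleGraph V) (k : ℕ) (c : V → ℕ) : Prop :=
  (∀ v, c v ∈ Set.Icc 1 k) ∧ ∀ i ∈ Set.Icc 1 k, IsPacking G i {v | c v = i}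

/-- The packing chromatic number of `G`: the smallest `k` for which `G` has a packing
`k`-coloring, and `⊤` if there is no such `k`. -/
noncomputable def packingChromaticNumber {V : Type*} (G : SimpleGraph V) : ℕ∞ :=
  ⨅ (k : ℕ) (_ : ∃ c : V → ℕ, IsPackingColoring G k c), (k : ℕ∞)

/-- The distance graph on the integers with distance set `D`: two distinct integers `i`, `j` are
adjacent if and only if `|i - j| ∈ D`. -/
def distanceGraph (D : Set ℤ) : SimpleGraph ℤ where
  Adj i j := i ≠ j ∧ |i - j| ∈ D
  symm := ⟨fun i j h => ⟨h.1.symm, by rw [abs_sub_comm]; exact h.2⟩⟩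
  loopless := ⟨fun _ h => h.1 rfl⟩

/-! Sending `(x, y)` to `x + t * y` does not increase distances, so a packing coloring of `D(1, t)`
pulls back to the grid. As `t ≥ 9`, distinct grid points within distance 11 have equal images only
if they differ by `±(9, -1)` or `±(10, -1)`, which matters for colors 10 and 11 only. A repeated
window of the coloring lets one pass to a finite cyclic quotient, where colors have densities.

Color `2 * m + 1` has density at most `1 / (2 * (m + 1) ^ 2)`, but the separate bounds for all
colors add up to more than 1. The gain comes from bad edges, those with no endpoint of color 1:
color 1 falls short of density 1/2 in proportion to their number. Color `2 * m` exceeds the bound of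
color `2 * m + 1` only through pairs of points at distance exactly `2 * m + 1`, on opposite sides of
an edge (`sum_edgeBall_le`). Edges that are not bad alternate between color 1 and other colors, so
by parity such a pair forces bad edges. The weights `oddWeight` (m = 1, 3) and `evenWeight` (m = 2)
charge the excess to ends of the edge where the alternation must have failed.

A discharging argument shows that the bad edges pay for the whole excess of colors 2, 4 and 6
(`total_slack_nonneg`). The local balance `slack` is nonnegative away from color 2; a point of color
2 is pooled with its neighbors. So colors 1, 2, 4, 6 together have density at most 1/2 + 1/8 + 1/18
+ 1/32, and all eleven have total density below 1. -/

/-! ### Grid colorings and balls. -/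

/-- The `ℓ¹` norm on the integer grid. -/
def gridNorm (v : ℤ × ℤ) : ℕ := v.1.natAbs + v.2.natAbs

/-- The four unit steps of the grid, in cyclic order. -/
def unitStep : Fin 4 → ℤ × ℤ := ![(1, 0), (0, 1), (-1, 0), (0, -1)]

/-- The coloring `G` seen from the point `v`. -/
def recenter (v : ℤ × ℤ) (G : ℤ × ℤ → ℕ) : ℤ × ℤ → ℕ := fun w => G (v + w)

/-- A coloring of the grid with colors `1, …, 11` in which two points of color `c` have distance
greater than `c`, except possibly when they differ by a multiple of `(9, -1)` or `(10, -1)`. -/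
structure GridPacking (G : ℤ × ℤ → ℕ) : Prop where
  mem_range : ∀ v, 1 ≤ G v ∧ G v ≤ 11
  packing : ∀ c ≤ 11, ∀ v w : ℤ × ℤ, gridNorm (v - w) ≤ c → (v - w).1 + 9 * (v - w).2 ≠ 0 →
    (v - w).1 + 10 * (v - w).2 ≠ 0 → G v = c → G w ≠ c

theorem GridPacking.recentered {G : ℤ × ℤ → ℕ} (hG : GridPacking G) (v : ℤ × ℤ) :
    GridPacking (recenter v G) where
  mem_range w := hG.mem_range _
  packing c hc u w h h9 h10 := by
    have e : v + u - (v + w) = u - w := by abel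
    show G (v + u) = c → G (v + w) ≠ c
    exact hG.packing c hc (v + u) (v + w) (by rwa [e]) (by rwa [e]) (by rwa [e])

/-- The exceptional differences have norm at least 10, so up to color 9 the packing condition has no
exceptions. -/
theorem GridPacking.eq_of_norm_le {G : ℤ × ℤ → ℕ} (hG : GridPacking G) {c : ℕ} (hc : c ≤ 9)
    {v w : ℤ × ℤ} (h : gridNorm (v - w) ≤ c) (hv : G v = c) (hw : G w = c) : v = w := by
  by_contra hne
  have hne' : v.1 ≠ w.1 ∨ v.2 ≠ w.2 := by
    by_contra! h'
    exact hne (Prod.ext h'.1 h'.2)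
  refine hG.packing c (by omega) v w h ?_ ?_ hv hw <;>
  · simp only [gridNorm, Prod.fst_sub, Prod.snd_sub] at h ⊢
    omega

/-- The indicator of a proposition. -/
noncomputable def indic (p : Prop) : ℝ := open Classical in if p then 1 else 0

theorem indic_of {p : Prop} (h : p) : indic p = 1 := by simp [indic, h]
theorem indic_not {p : Prop} (h : ¬p) : indic p = 0 := by simp [indic, h]
theorem indic_nonneg (p : Prop) : 0 ≤ indic p := by by_cases h : p <;> simp [indic, h]
theorem indic_le_one (p : Prop) : indic p ≤ 1 := by by_cases h : p <;> simp [indic, h]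

/-- The ball of radius `m` around the origin. -/
def gridBall (m : ℕ) : Finset (ℤ × ℤ) :=
  ((Finset.range (2 * m + 1) ×ˢ Finset.range (2 * m + 1)).image
    fun p => ((p.1 : ℤ) - m, (p.2 : ℤ) - m)).filter fun v => gridNorm v ≤ m

theorem mem_gridBall {m : ℕ} {v : ℤ × ℤ} : v ∈ gridBall m ↔ gridNorm v ≤ m := by
  rw [gridBall, Finset.mem_filter, and_iff_right_iff_imp]
  intro h
  rw [gridNorm] at h
  simp only [Finset.mem_image, Finset.mem_product, Finset.mem_range]
  exact ⟨((v.1 + m).toNat, (v.2 + m).toNat), by simp only; omega,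
    Prod.ext (by simp only; omega) (by simp only; omega)⟩

/-- The points at distance `m` from the origin and `m + 1` from its `i`-th neighbor. -/
def behind (m : ℕ) (i : Fin 4) : Finset (ℤ × ℤ) :=
  (gridBall m).filter fun u => gridNorm u = m ∧ gridNorm (u - unitStep i) = m + 1

theorem mem_behind {m : ℕ} {i : Fin 4} {u : ℤ × ℤ} :
    u ∈ behind m i ↔ gridNorm u = m ∧ gridNorm (u - unitStep i) = m + 1 := by
  simp only [behind, Finset.mem_filter, mem_gridBall]
  omega

/-- The points within distance `m` of the origin or of its `i`-th neighbor. -/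
def edgeBall (m : ℕ) (i : Fin 4) : Finset (ℤ × ℤ) :=
  gridBall m ∪ (gridBall m).image (unitStep i + ·)

theorem mem_edgeBall {m : ℕ} {i : Fin 4} {v : ℤ × ℤ} :
    v ∈ edgeBall m i ↔ gridNorm v ≤ m ∨ gridNorm (v - unitStep i) ≤ m := by
  simp only [edgeBall, Finset.mem_union, Finset.mem_image, mem_gridBall]
  refine or_congr Iff.rfl ⟨?_, fun h => ⟨_, h, by abel⟩⟩
  rintro ⟨w, hw, rfl⟩
  simpa using hw

theorem unitStep_add_two (i : Fin 4) : unitStep (i + 2) = -unitStep i := by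
  revert i; decide

theorem gridNorm_unitStep (i : Fin 4) : gridNorm (unitStep i) = 1 := by
  revert i; decide

theorem gridNorm_add_le (v w : ℤ × ℤ) : gridNorm (v + w) ≤ gridNorm v + gridNorm w := by
  simp only [gridNorm, Prod.fst_add, Prod.snd_add]
  omega

theorem gridNorm_sub_le (v w : ℤ × ℤ) : gridNorm (v - w) ≤ gridNorm v + gridNorm w := by
  simp only [gridNorm, Prod.fst_sub, Prod.snd_sub]
  omega

theorem gridNorm_neg (v : ℤ × ℤ) : gridNorm (-v) = gridNorm v := by
  simp [gridNorm]

theorem sum_indic_le_one {D : Finset (ℤ × ℤ)} {p : ℤ × ℤ → Prop}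
    (h : ∀ v ∈ D, ∀ w ∈ D, p v → p w → v = w) : ∑ v ∈ D, indic (p v) ≤ 1 := by
  classical
  by_cases hex : ∃ v ∈ D, p v
  · obtain ⟨v, hv, hpv⟩ := hex
    rw [Finset.sum_eq_single_of_mem v hv fun w hw hne =>
      indic_not fun hpw => hne (h w hw v hv hpw hpv)]
    exact indic_le_one _
  · push Not at hex
    rw [Finset.sum_eq_zero fun v hv => indic_not (hex v hv)]
    exact zero_le_one

/-! ### Counting an even color around an edge. -/

/-- The number of points of color `2 * m` near an edge is at most one, up to a correction by
weights `ψ₀`, `ψ₁` of the two orientations of the edge. -/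
theorem GridPacking.sum_edgeBall_le {G : ℤ × ℤ → ℕ} (hG : GridPacking G) {m : ℕ} (hm : m ≤ 4)
    (i : Fin 4) {ψ₀ ψ₁ : ℝ} (h₀ : 0 ≤ ψ₀) (h₁ : 0 ≤ ψ₁) (h : 1 ≤ ψ₀ + ψ₁) :
    ∑ v ∈ edgeBall m i, indic (G v = 2 * m) ≤
      1 + ∑ u ∈ behind m i, indic (G u = 2 * m) * ψ₀ +
        ∑ u ∈ behind m (i + 2), indic (G (unitStep i + u) = 2 * m) * ψ₁ := by
  have hb : ∀ v w : ℤ × ℤ, gridNorm v ≤ m → gridNorm w ≤ m → gridNorm (v - w) ≤ 2 * m := by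
    intro v w hv hw
    have := gridNorm_sub_le v w
    omega
  have hs₀ : 0 ≤ ∑ u ∈ behind m i, indic (G u = 2 * m) * ψ₀ :=
    Finset.sum_nonneg fun u _ => mul_nonneg (indic_nonneg _) h₀
  have hs₁ : 0 ≤ ∑ u ∈ behind m (i + 2), indic (G (unitStep i + u) = 2 * m) * ψ₁ :=
    Finset.sum_nonneg fun u _ => mul_nonneg (indic_nonneg _) h₁
  -- Two points of the color must come from different balls. Their distance is then exactly `2 * m +
  -- 1`, so each lies behind its own center, and `ψ₀ + ψ₁ ≥ 1` pays for the second point.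
  by_cases hex : ∃ u v : ℤ × ℤ, gridNorm u ≤ m ∧ gridNorm v ≤ m ∧ G u = 2 * m ∧
      G (unitStep i + v) = 2 * m ∧ u ≠ unitStep i + v
  · obtain ⟨u, v, hu, hv, hcu, hcv, hne⟩ := hex
    have hd : ¬ gridNorm (u - (unitStep i + v)) ≤ 2 * m := fun hle =>
      hne (hG.eq_of_norm_le (by omega) hle hcu hcv)
    have e1 : u - (unitStep i + v) = (u - unitStep i) - v := by abel
    have e3 : v - unitStep (i + 2) = unitStep i + v := by rw [unitStep_add_two]; abel
    have n1 := gridNorm_sub_le (u - unitStep i) v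
    have n2 := gridNorm_sub_le u (unitStep i + v)
    have n3 := gridNorm_sub_le u (unitStep i)
    have n4 := gridNorm_add_le (unitStep i) v
    rw [gridNorm_unitStep] at n3 n4
    rw [← e1] at n1
    have hu' : u ∈ behind m i := mem_behind.2 (by omega)
    have hv' : v ∈ behind m (i + 2) := mem_behind.2 (by rw [e3]; omega)
    have t₀ : ψ₀ ≤ ∑ u ∈ behind m i, indic (G u = 2 * m) * ψ₀ := by
      refine le_trans ?_ (Finset.single_le_sum
        (fun u _ => mul_nonneg (indic_nonneg (G u = 2 * m)) h₀) hu')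
      rw [indic_of hcu, one_mul]
    have t₁ : ψ₁ ≤ ∑ u ∈ behind m (i + 2), indic (G (unitStep i + u) = 2 * m) * ψ₁ := by
      refine le_trans ?_ (Finset.single_le_sum
        (fun u _ => mul_nonneg (indic_nonneg (G (unitStep i + u) = 2 * m)) h₁) hv')
      rw [indic_of hcv, one_mul]
    have c₀ : ∑ v ∈ gridBall m, indic (G v = 2 * m) ≤ 1 :=
      sum_indic_le_one fun v hv w hw hv' hw' => hG.eq_of_norm_le (by omega)
        (hb v w (mem_gridBall.1 hv) (mem_gridBall.1 hw)) hv' hw'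
    have c₁ : ∑ v ∈ (gridBall m).image (unitStep i + ·), indic (G v = 2 * m) ≤ 1 := by
      refine sum_indic_le_one fun v hv w hw hv' hw' => ?_
      obtain ⟨v, hvm, rfl⟩ := Finset.mem_image.1 hv
      obtain ⟨w, hwm, rfl⟩ := Finset.mem_image.1 hw
      refine hG.eq_of_norm_le (by omega) ?_ hv' hw'
      rw [add_sub_add_left_eq_sub]
      exact hb v w (mem_gridBall.1 hvm) (mem_gridBall.1 hwm)
    have c₂ : ∑ v ∈ edgeBall m i, indic (G v = 2 * m) ≤ ∑ v ∈ gridBall m, indic (G v = 2 * m) +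
        ∑ v ∈ (gridBall m).image (unitStep i + ·), indic (G v = 2 * m) := by
      rw [← Finset.sum_union_inter]
      exact le_add_of_nonneg_right (Finset.sum_nonneg fun _ _ => indic_nonneg _)
    linarith
  · push Not at hex
    have : ∑ v ∈ edgeBall m i, indic (G v = 2 * m) ≤ 1 := by
      refine sum_indic_le_one fun v hv w hw hv' hw' => ?_
      have split : ∀ x, x = unitStep i + (x - unitStep i) := fun x => by abel
      rcases mem_edgeBall.1 hv with hv | hv <;> rcases mem_edgeBall.1 hw with hw | hw
      · exact hG.eq_of_norm_le (by omega) (hb v w hv hw) hv' hw'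
      · rw [split w] at hw' ⊢
        exact hex v _ hv hw hv' hw'
      · rw [split v] at hv' ⊢
        exact (hex w _ hw hv hw' hv').symm
      · refine hG.eq_of_norm_le (by omega) ?_ hv' hw'
        rw [← sub_sub_sub_cancel_right v w (unitStep i)]
        exact hb _ _ hv hw
    linarith

/-! ### Bad edges and half-edge weights. -/

/-- The indicator of `v` not having color `1`. -/
noncomputable def nonOne (G : ℤ × ℤ → ℕ) (v : ℤ × ℤ) : ℝ := indic (G v ≠ 1)

theorem nonOne_of_ne {G : ℤ × ℤ → ℕ} {v : ℤ × ℤ} (h : G v ≠ 1) : nonOne G v = 1 := indic_of h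
theorem nonOne_of_eq {G : ℤ × ℤ → ℕ} {v : ℤ × ℤ} (h : G v = 1) : nonOne G v = 0 :=
  indic_not (not_not.2 h)
theorem nonOne_nonneg (G : ℤ × ℤ → ℕ) (v : ℤ × ℤ) : 0 ≤ nonOne G v := indic_nonneg _
theorem nonOne_le_one (G : ℤ × ℤ → ℕ) (v : ℤ × ℤ) : nonOne G v ≤ 1 := indic_le_one _

/-- The number of neighbors of the origin whose color is not `1`. -/
def badDegree (G : ℤ × ℤ → ℕ) : ℕ := (Finset.univ.filter fun i => G (unitStep i) ≠ 1).card

theorem badDegree_le (G : ℤ × ℤ → ℕ) : badDegree G ≤ 4 := Finset.card_filter_le _ _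

theorem sum_nonOne (G : ℤ × ℤ → ℕ) : ∑ i, nonOne G (unitStep i) = badDegree G := by
  classical
  rw [badDegree, Finset.card_filter]
  push_cast
  refine Finset.sum_congr rfl fun i _ => ?_
  by_cases h : G (unitStep i) = 1 <;> simp [nonOne, indic, h]

theorem badDegree_pos {G : ℤ × ℤ → ℕ} {i : Fin 4} (h : G (unitStep i) ≠ 1) : 1 ≤ badDegree G :=
  Finset.card_pos.2 ⟨i, by simpa using h⟩

theorem eq_of_badDegree_eq_one {G : ℤ × ℤ → ℕ} (h : badDegree G = 1) {i j : Fin 4}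
    (hi : G (unitStep i) ≠ 1) (hj : G (unitStep j) ≠ 1) : i = j :=
  Finset.card_le_one.1 h.le i (by simpa using hi) j (by simpa using hj)

/-- The weight of the half-edge in direction `i` used for the colors `2` and `6`. -/
noncomputable def oddWeight (i : Fin 4) (G : ℤ × ℤ → ℕ) : ℝ :=
  nonOne G 0 * (1 - nonOne G (unitStep i) / 2)

/-- The weight of the half-edge in direction `i` used for the color `4`. -/
noncomputable def evenWeight (i : Fin 4) (G : ℤ × ℤ → ℕ) : ℝ :=
  1 - nonOne G 0 + nonOne G 0 * nonOne G (unitStep i) / 2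

theorem oddWeight_nonneg (i : Fin 4) (G : ℤ × ℤ → ℕ) : 0 ≤ oddWeight i G :=
  mul_nonneg (nonOne_nonneg _ _) (by linarith [nonOne_le_one G (unitStep i)])

theorem oddWeight_le_one (i : Fin 4) (G : ℤ × ℤ → ℕ) : oddWeight i G ≤ 1 :=
  mul_le_one₀ (nonOne_le_one _ _) (by linarith [nonOne_le_one G (unitStep i)])
    (by linarith [nonOne_nonneg G (unitStep i)])

theorem evenWeight_nonneg (i : Fin 4) (G : ℤ × ℤ → ℕ) : 0 ≤ evenWeight i G := by
  have := mul_nonneg (nonOne_nonneg G 0) (nonOne_nonneg G (unitStep i))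
  have := nonOne_le_one G 0
  unfold evenWeight
  linarith

theorem GridPacking.ne_one {G : ℤ × ℤ → ℕ} (hG : GridPacking G) {v w : ℤ × ℤ}
    (hv : G v = 1) (h : gridNorm (v - w) = 1) : G w ≠ 1 := by
  intro hw
  rw [hG.eq_of_norm_le (by omega) h.le hv hw, sub_self] at h
  exact absurd h (by decide)

theorem GridPacking.ne_one_unitStep {G : ℤ × ℤ → ℕ} (hG : GridPacking G) (i : Fin 4)
    (h : G 0 = 1) : G (unitStep i) ≠ 1 :=
  hG.ne_one h (by rw [zero_sub, gridNorm_neg, gridNorm_unitStep])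

theorem recenter_zero (v : ℤ × ℤ) (G : ℤ × ℤ → ℕ) : recenter v G 0 = G v := by simp [recenter]

theorem recenter_step_back (i : Fin 4) (G : ℤ × ℤ → ℕ) :
    recenter (unitStep i) G (unitStep (i + 2)) = G 0 := by simp [recenter, unitStep_add_two]

theorem one_le_oddWeight_add {G : ℤ × ℤ → ℕ} (hG : GridPacking G) (i : Fin 4) :
    1 ≤ oddWeight i G + oddWeight (i + 2) (recenter (unitStep i) G) := by
  have h := hG.ne_one_unitStep i
  simp only [oddWeight, nonOne, recenter_zero, recenter_step_back]
  by_cases h0 : G 0 = 1 <;> by_cases h1 : G (unitStep i) = 1 <;> simp_all [indic]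
  norm_num

theorem one_le_evenWeight_add {G : ℤ × ℤ → ℕ} (hG : GridPacking G) (i : Fin 4) :
    1 ≤ evenWeight i G + evenWeight (i + 2) (recenter (unitStep i) G) := by
  have h := hG.ne_one_unitStep i
  simp only [evenWeight, nonOne, recenter_zero, recenter_step_back]
  by_cases h0 : G 0 = 1 <;> by_cases h1 : G (unitStep i) = 1 <;> simp_all [indic]
  norm_num

/-! ### Loads, moved where necessary to an end of a bad edge. -/

/-- The weighted number of points of color `2 * m` on the sphere of radius `m`, each counted once
for every direction pointing away from it. -/
noncomputable def sphereSum (m : ℕ) (G : ℤ × ℤ → ℕ) (w : Fin 4 → ℤ × ℤ → ℝ) : ℝ :=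
  ∑ i, ∑ u ∈ behind m i, indic (G u = 2 * m) * w i u

theorem sphereSum_eq_zero {m : ℕ} {G : ℤ × ℤ → ℕ} (w : Fin 4 → ℤ × ℤ → ℝ)
    (h : ∀ u, gridNorm u = m → G u ≠ 2 * m) : sphereSum m G w = 0 :=
  Finset.sum_eq_zero fun i _ => Finset.sum_eq_zero fun u hu => by
    rw [indic_not (h u (mem_behind.1 hu).1), zero_mul]

theorem GridPacking.sphereSum_eq {G : ℤ × ℤ → ℕ} (hG : GridPacking G) {m : ℕ} (hm : m ≤ 4)
    (w : Fin 4 → ℤ × ℤ → ℝ) {u₀ : ℤ × ℤ} (hu₀ : gridNorm u₀ = m) (hc : G u₀ = 2 * m) :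
    sphereSum m G w = ∑ i, indic (gridNorm (u₀ - unitStep i) = m + 1) * w i u₀ := by
  refine Finset.sum_congr rfl fun i _ => ?_
  have huniq : ∀ u ∈ behind m i, u ≠ u₀ → indic (G u = 2 * m) * w i u = 0 := by
    intro u hu hne
    rw [indic_not, zero_mul]
    intro hcu
    refine hne (hG.eq_of_norm_le (by omega) ?_ hcu hc)
    have := gridNorm_sub_le u u₀
    have := (mem_behind.1 hu).1
    omega
  by_cases hmem : gridNorm (u₀ - unitStep i) = m + 1
  · rw [Finset.sum_eq_single_of_mem u₀ (mem_behind.2 ⟨hu₀, hmem⟩) huniq, indic_of hc, indic_of hmem]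
  · rw [indic_not hmem, zero_mul]
    refine Finset.sum_eq_zero fun u hu => huniq u hu ?_
    rintro rfl
    exact hmem (mem_behind.1 hu).2

theorem sum_indic_mul_le {P : Fin 4 → Prop} {g : Fin 4 → ℝ} (hg : ∀ i, 0 ≤ g i) {e : Fin 4}
    (he : ¬P e) : ∑ i, indic (P i) * g i ≤ ∑ i, g i - g e := by
  rw [← Finset.sum_erase_eq_sub (Finset.mem_univ e),
    ← Finset.add_sum_erase _ (fun i => indic (P i) * g i) (Finset.mem_univ e), indic_not he,
    zero_mul, zero_add]
  exact Finset.sum_le_sum fun i _ => mul_le_of_le_one_left (hg i) (indic_le_one _)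

/-- No neighbor of `u` on the way to the origin has color `1`, for `u` at distance `3`. -/
def Blocked (G : ℤ × ℤ → ℕ) (u : ℤ × ℤ) : Prop :=
  ∀ j, gridNorm (u + unitStep j) = 2 → G (u + unitStep j) ≠ 1

/-- The load put on the origin by an adjacent point of color `2`. -/
noncomputable def loadTwo (G : ℤ × ℤ → ℕ) : ℝ := sphereSum 1 G fun i _ => oddWeight i G

/-- The load put on the origin by a point of color `4` at distance `2`. -/
noncomputable def loadFour (G : ℤ × ℤ → ℕ) : ℝ :=
  sphereSum 2 G fun i _ => nonOne G 0 * nonOne G (unitStep i) / 2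

/-- The load put on the origin by a point of color `6` at distance `3`. -/
noncomputable def loadSix (G : ℤ × ℤ → ℕ) : ℝ :=
  sphereSum 3 G fun i u => (1 - indic (Blocked G u)) * oddWeight i G

/-- The load put on the origin by the sphere of radius `2` if the origin has color `4`. -/
noncomputable def ownFour (G : ℤ × ℤ → ℕ) : ℝ :=
  ∑ i, ∑ u ∈ behind 2 i, indic (G 0 = 4) * (1 - nonOne G (-u))

/-- The load put on the origin by the sphere of radius `3` if the origin has color `6`. -/
noncomputable def ownSix (G : ℤ × ℤ → ℕ) : ℝ :=
  ∑ i, ∑ u ∈ behind 3 i, indic (G 0 = 6) * (indic (Blocked (recenter (-u) G) u) *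
    oddWeight i (recenter (-u) G))

theorem sum_pay (G : ℤ × ℤ → ℕ) :
    ∑ i, (1 - nonOne G (unitStep i) / 2) = 4 - (badDegree G : ℝ) / 2 := by
  rw [Finset.sum_sub_distrib, ← Finset.sum_div, sum_nonOne]
  simp

/-- A direction weighs at most 1, and at most 1/2 if its neighbor is not of color 1. All four give
`4 - badDegree G / 2`, and leaving out `e` saves 1/2. -/
theorem sum_oddWeight_away_le {G : ℤ × ℤ → ℕ} {P : Fin 4 → Prop} {e : Fin 4} (he : ¬P e)
    (h : G (unitStep e) ≠ 1) :
    ∑ i, indic (P i) * oddWeight i G ≤ (7 - badDegree G) / 2 := by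
  have h1 : ∑ i, indic (P i) * oddWeight i G ≤
      ∑ i, indic (P i) * (1 - nonOne G (unitStep i) / 2) := by
    refine Finset.sum_le_sum fun i _ => mul_le_mul_of_nonneg_left ?_ (indic_nonneg _)
    exact mul_le_of_le_one_left (by linarith [nonOne_le_one G (unitStep i)]) (nonOne_le_one _ _)
  have h2 := sum_indic_mul_le (P := P) (g := fun i => 1 - nonOne G (unitStep i) / 2)
    (fun i => by linarith [nonOne_le_one G (unitStep i)]) he
  rw [sum_pay] at h2
  simp only [nonOne_of_ne h] at h2
  linarith

theorem GridPacking.loadTwo_le {G : ℤ × ℤ → ℕ} (hG : GridPacking G) {j : Fin 4}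
    (hj : G (unitStep j) = 2) : loadTwo G ≤ (7 - badDegree G) / 2 := by
  rw [loadTwo, hG.sphereSum_eq (by norm_num) _ (gridNorm_unitStep j) hj]
  refine sum_oddWeight_away_le (e := j) ?_ (by omega)
  rw [sub_self]
  decide

theorem exists_unitStep_of_norm_one {u : ℤ × ℤ} (h : gridNorm u = 1) : ∃ i, u = unitStep i := by
  have : ∀ u ∈ gridBall 1, gridNorm u = 1 → ∃ i, u = unitStep i := by decide +kernel
  exact this u (mem_gridBall.2 h.le) h

theorem loadTwo_eq_zero {G : ℤ × ℤ → ℕ} (h : ∀ j, G (unitStep j) ≠ 2) : loadTwo G = 0 := by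
  refine sphereSum_eq_zero _ fun u hu => ?_
  obtain ⟨i, rfl⟩ := exists_unitStep_of_norm_one hu
  exact h i

theorem loadFour_le (G : ℤ × ℤ → ℕ) (hG : GridPacking G) : loadFour G ≤ badDegree G / 2 := by
  have hb : (0 : ℝ) ≤ badDegree G / 2 := by positivity
  by_cases h : ∃ u, gridNorm u = 2 ∧ G u = 2 * 2
  · obtain ⟨u, hu, hc⟩ := h
    rw [loadFour, hG.sphereSum_eq (by norm_num) _ hu hc, ← sum_nonOne, Finset.sum_div]
    refine Finset.sum_le_sum fun i _ => ?_
    have h0 := nonOne_nonneg G (unitStep i)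
    have h1 : nonOne G 0 * nonOne G (unitStep i) ≤ nonOne G (unitStep i) :=
      mul_le_of_le_one_left h0 (nonOne_le_one _ _)
    have h2 : 0 ≤ nonOne G 0 * nonOne G (unitStep i) := mul_nonneg (nonOne_nonneg _ _) h0
    refine (mul_le_of_le_one_left (by linarith) (indic_le_one _)).trans (by linarith)
  · push Not at h
    rw [loadFour, sphereSum_eq_zero _ h]
    exact hb

theorem GridPacking.loadFour_eq_zero {G : ℤ × ℤ → ℕ} (hG : GridPacking G) {v : ℤ × ℤ}
    (hv : gridNorm v ≤ 1) (h : G v = 4) : loadFour G = 0 := by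
  refine sphereSum_eq_zero _ fun u hu hc => ?_
  have h1 := gridNorm_sub_le u v
  obtain rfl := hG.eq_of_norm_le (by norm_num) (by omega) hc h
  omega

theorem GridPacking.loadSix_eq_zero {G : ℤ × ℤ → ℕ} (hG : GridPacking G) {v : ℤ × ℤ}
    (hv : gridNorm v ≤ 2) (h : G v = 6) : loadSix G = 0 := by
  refine sphereSum_eq_zero _ fun u hu hc => ?_
  have h1 := gridNorm_sub_le u v
  obtain rfl := hG.eq_of_norm_le (by norm_num) (by omega) hc h
  omega

/-- If the load of a point of color `6` at distance `3` is not zero, some neighbor of the origin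
towards that point neither has color `1` nor only neighbors of other colors. -/
theorem GridPacking.loadSix_cases {G : ℤ × ℤ → ℕ} (hG : GridPacking G) :
    loadSix G = 0 ∨ ∃ (u : ℤ × ℤ) (e : Fin 4), G u = 6 ∧ gridNorm (u - unitStep e) = 2 ∧
      G (unitStep e) ≠ 1 ∧ (∃ k, G (unitStep e + unitStep k) = 1) ∧
      loadSix G ≤ (7 - badDegree G) / 2 := by
  by_cases h : ∃ u, gridNorm u = 3 ∧ G u = 2 * 3
  · obtain ⟨u, hu, hc⟩ := h
    have hsum := hG.sphereSum_eq (by norm_num) (fun i u => (1 - indic (Blocked G u)) * oddWeight i G)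
      hu hc
    by_cases hb : Blocked G u
    · left
      rw [loadSix, hsum]
      exact Finset.sum_eq_zero fun i _ => by rw [indic_of hb]; ring
    · right
      have hb' := hb
      simp only [Blocked, not_forall, not_not] at hb'
      obtain ⟨j, hj, hj1⟩ := hb'
      -- Some shortest path from `u` to the origin runs through the color-1 point `u + unitStep j`;
      -- its next point `unitStep e` cannot have color 1.
      have key : ∀ u ∈ gridBall 3, gridNorm u = 3 → ∀ j, gridNorm (u + unitStep j) = 2 →
          ∃ e k, gridNorm (u - unitStep e) = 2 ∧ u + unitStep j = unitStep e + unitStep k := by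
        decide +kernel
      obtain ⟨e, k, he, hk⟩ := key u (mem_gridBall.2 hu.le) hu j hj
      have hne : G (unitStep e) ≠ 1 := by
        refine hG.ne_one hj1 ?_
        rw [hk, add_sub_cancel_left, gridNorm_unitStep]
      refine ⟨u, e, hc, he, hne, ⟨k, hk ▸ hj1⟩, ?_⟩
      rw [loadSix, hsum]
      simp only [indic_not hb, sub_zero, one_mul]
      exact sum_oddWeight_away_le (by rw [he]; norm_num) hne
  · left
    push Not at h
    exact sphereSum_eq_zero _ h

theorem GridPacking.loadSix_le {G : ℤ × ℤ → ℕ} (hG : GridPacking G) :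
    loadSix G ≤ (7 - badDegree G) / 2 := by
  have hb : (badDegree G : ℝ) ≤ 4 := by exact_mod_cast badDegree_le G
  rcases hG.loadSix_cases with h | ⟨u, e, -, -, -, -, h⟩
  · rw [h]; linarith
  · exact h

theorem GridPacking.loadSix_of_badDegree_eq_zero {G : ℤ × ℤ → ℕ} (hG : GridPacking G)
    (h : badDegree G = 0) : loadSix G = 0 := by
  rcases hG.loadSix_cases with h' | ⟨u, e, -, -, he, -, -⟩
  · exact h'
  · have := badDegree_pos he
    omega

/-- The number of pairs of a direction `i` and a point behind it at distance `m` from which the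
origin is reached only through neighbors in `β`. -/
def reachCount (m : ℕ) (β : Fin 4 → Bool) : ℕ :=
  ∑ i, ((behind m i).filter fun u => ∀ j, gridNorm (u + unitStep j) + 1 = m → β j = true).card

/-- A check of all 16 subsets. The list is indexed by the size of the subset, so the default value
is never used. -/
theorem reachCount_two_le (β : Fin 4 → Bool) :
    reachCount 2 β ≤ [0, 3, 8, 13, 20].getD (Finset.univ.filter fun i => β i = true).card 0 := by
  revert β; decide +kernel

theorem reachCount_three_le (β : Fin 4 → Bool) :
    reachCount 3 β ≤ [0, 3, 10, 17, 28].getD (Finset.univ.filter fun i => β i = true).card 0 := by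
  revert β; decide +kernel

theorem sum_behind_le_reachCount {m : ℕ} (G : ℤ × ℤ → ℕ) (g : Fin 4 → ℤ × ℤ → ℝ)
    (h1 : ∀ i u, g i u ≤ 1)
    (h0 : ∀ i, ∀ u ∈ behind m i, ∀ j, gridNorm (u + unitStep j) + 1 = m → G (unitStep j) = 1 →
      g i u ≤ 0) :
    ∑ i, ∑ u ∈ behind m i, g i u ≤ reachCount m fun j => decide (G (unitStep j) ≠ 1) := by
  rw [reachCount]
  push_cast
  refine Finset.sum_le_sum fun i _ => ?_
  rw [Finset.card_filter]
  push_cast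
  refine Finset.sum_le_sum fun u hu => ?_
  split_ifs with h
  · exact h1 i u
  · simp only [not_forall] at h
    obtain ⟨j, hj, hj'⟩ := h
    exact h0 i u hu j hj (by simpa using hj')

/-- If a neighbor on the way to `-u` has color 1, then `-u` has not, and its term vanishes. -/
theorem GridPacking.ownFour_le {G : ℤ × ℤ → ℕ} (hG : GridPacking G) :
    ownFour G ≤ ([0, 3, 8, 13, 20].getD (badDegree G) 0 : ℕ) := by
  have h := sum_behind_le_reachCount (m := 2) G (fun _ u => indic (G 0 = 4) * (1 - nonOne G (-u)))
    (fun i u => mul_le_one₀ (indic_le_one _) (by linarith [nonOne_le_one G (-u)])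
      (by linarith [nonOne_nonneg G (-u)])) ?_
  · refine h.trans ?_
    have := reachCount_two_le fun j => decide (G (unitStep j) ≠ 1)
    simp only [decide_eq_true_eq] at this
    exact_mod_cast this
  · intro i u hu j hj h1
    rw [nonOne_of_ne, sub_self, mul_zero]
    refine hG.ne_one h1 ?_
    rw [sub_neg_eq_add, add_comm]
    omega

theorem ownSix_le (G : ℤ × ℤ → ℕ) :
    ownSix G ≤ ([0, 3, 10, 17, 28].getD (badDegree G) 0 : ℕ) := by
  have h := sum_behind_le_reachCount (m := 3) G (fun i u => indic (G 0 = 6) *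
      (indic (Blocked (recenter (-u) G) u) * oddWeight i (recenter (-u) G)))
    (fun i u => mul_le_one₀ (indic_le_one _)
      (mul_nonneg (indic_nonneg _) (oddWeight_nonneg _ _))
      (mul_le_one₀ (indic_le_one _) (oddWeight_nonneg _ _) (oddWeight_le_one _ _))) ?_
  · refine h.trans ?_
    have := reachCount_three_le fun j => decide (G (unitStep j) ≠ 1)
    simp only [decide_eq_true_eq] at this
    exact_mod_cast this
  · intro i u hu j hj h1
    rw [indic_not (p := Blocked _ _), zero_mul, mul_zero]
    intro hb
    refine hb j (by omega) ?_
    simpa [recenter] using h1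

theorem ownFour_eq_zero {G : ℤ × ℤ → ℕ} (h : G 0 ≠ 4) : ownFour G = 0 := by
  simp [ownFour, indic_not h]

theorem ownSix_eq_zero {G : ℤ × ℤ → ℕ} (h : G 0 ≠ 6) : ownSix G = 0 := by
  simp [ownSix, indic_not h]

/-! ### Capacity and local slack. -/

/-- The part of a bad edge that is given to its endpoint of color `a` if the other endpoint has
color `b`. -/
noncomputable def share (a b : ℕ) : ℝ :=
  -- Color 4 needs more than half because of `ownFour`: with four bad edges, halves give 2, less
  -- than the bound 20/9. The deficit of color 2 is made up by pooling.
  if a = 2 then 0 else if b = 2 then 1 else if a = 4 then 18 / 25 else if b = 4 then 7 / 25 else 1 / 2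

/-- The total part of the bad edges at the origin that is given to the origin. -/
noncomputable def capacity (G : ℤ × ℤ → ℕ) : ℝ :=
  ∑ i, nonOne G 0 * nonOne G (unitStep i) * share (G 0) (G (unitStep i))

/-- Capacity minus load of the origin. -/
noncomputable def slack (G : ℤ × ℤ → ℕ) : ℝ :=
  -- The divisors are `(m + 1) ^ 2`: the load of color `2 * m` enters its count with factor `1 / (4
  -- * (m + 1) ^ 2)`, while color 1 loses a quarter of the capacity.
  capacity G - (loadTwo G / 4 + loadFour G / 9 + ownFour G / 9 + loadSix G / 16 + ownSix G / 16)

/-- The number of neighbors of the origin of color `c`. -/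
noncomputable def nbrCount (c : ℕ) (G : ℤ × ℤ → ℕ) : ℝ := ∑ i, indic (G (unitStep i) = c)

theorem nbrCount_eq_zero {c : ℕ} {G : ℤ × ℤ → ℕ} (h : ∀ i, G (unitStep i) ≠ c) :
    nbrCount c G = 0 :=
  Finset.sum_eq_zero fun i _ => indic_not (h i)

theorem unitStep_injective : Function.Injective unitStep := by decide

theorem GridPacking.unitStep_unique {G : ℤ × ℤ → ℕ} (hG : GridPacking G) {c : ℕ} (h2 : 2 ≤ c)
    (h9 : c ≤ 9) {i j : Fin 4} (hi : G (unitStep i) = c) (hj : G (unitStep j) = c) : i = j := by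
  refine unitStep_injective (hG.eq_of_norm_le h9 ?_ hi hj)
  have := gridNorm_sub_le (unitStep i) (unitStep j)
  rw [gridNorm_unitStep, gridNorm_unitStep] at this
  omega

theorem GridPacking.nbrCount_eq_one {G : ℤ × ℤ → ℕ} (hG : GridPacking G) {c : ℕ} (h2 : 2 ≤ c)
    (h9 : c ≤ 9) {i : Fin 4} (hi : G (unitStep i) = c) : nbrCount c G = 1 := by
  rw [nbrCount, Finset.sum_eq_single_of_mem i (Finset.mem_univ i) fun j _ hne =>
    indic_not fun hj => hne (hG.unitStep_unique h2 h9 hj hi), indic_of hi]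

theorem GridPacking.nbrCount_cases {G : ℤ × ℤ → ℕ} (hG : GridPacking G) {c : ℕ} (h2 : 2 ≤ c)
    (h9 : c ≤ 9) : nbrCount c G = 0 ∨ (nbrCount c G = 1 ∧ ∃ i, G (unitStep i) = c) := by
  by_cases h : ∃ i, G (unitStep i) = c
  · exact Or.inr ⟨hG.nbrCount_eq_one h2 h9 h.choose_spec, h⟩
  · push Not at h
    exact Or.inl (nbrCount_eq_zero h)

theorem slack_of_one {G : ℤ × ℤ → ℕ} (h : G 0 = 1) : slack G = 0 := by
  have h0 := nonOne_of_eq h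
  simp [slack, capacity, loadTwo, loadFour, loadSix, sphereSum, oddWeight, h0,
    ownFour_eq_zero (G := G) (by omega), ownSix_eq_zero (G := G) (by omega)]

theorem GridPacking.ne_unitStep {G : ℤ × ℤ → ℕ} (hG : GridPacking G) {c : ℕ} (h1 : 1 ≤ c)
    (h9 : c ≤ 9) (h : G 0 = c) (i : Fin 4) : G (unitStep i) ≠ c := by
  intro hi
  have := hG.eq_of_norm_le h9 (v := unitStep i) (w := 0)
    (by rw [sub_zero, gridNorm_unitStep]; exact h1) hi h
  exact (by decide : ∀ i, unitStep i ≠ 0) i this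

theorem slack_of_two {G : ℤ × ℤ → ℕ} (hG : GridPacking G) (h : G 0 = 2) :
    slack G = -(loadFour G / 9 + loadSix G / 16) := by
  have hc : capacity G = 0 := Finset.sum_eq_zero fun i _ => by simp [share, h]
  rw [slack, hc, loadTwo_eq_zero (hG.ne_unitStep (by norm_num) (by norm_num) h),
    ownFour_eq_zero (by omega), ownSix_eq_zero (by omega)]
  ring

theorem capacity_of_four {G : ℤ × ℤ → ℕ} (h : G 0 = 4) :
    capacity G = 18 / 25 * badDegree G + 7 / 25 * nbrCount 2 G := by
  rw [capacity, ← sum_nonOne, nbrCount, Finset.mul_sum, Finset.mul_sum, ← Finset.sum_add_distrib]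
  refine Finset.sum_congr rfl fun i _ => ?_
  rw [nonOne_of_ne (v := 0) (by omega), share, h]
  by_cases h1 : G (unitStep i) = 1
  · simp [nonOne_of_eq h1, indic, h1]
  · by_cases h2 : G (unitStep i) = 2 <;> simp [nonOne_of_ne h1, indic, h2]
    norm_num

theorem capacity_of_ne {G : ℤ × ℤ → ℕ} (h1 : G 0 ≠ 1) (h2 : G 0 ≠ 2) (h4 : G 0 ≠ 4) :
    capacity G = badDegree G / 2 + nbrCount 2 G / 2 - 11 / 50 * nbrCount 4 G := by
  rw [capacity, ← sum_nonOne, nbrCount, nbrCount, Finset.mul_sum, Finset.sum_div, Finset.sum_div,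
    ← Finset.sum_add_distrib, ← Finset.sum_sub_distrib]
  refine Finset.sum_congr rfl fun i _ => ?_
  rw [nonOne_of_ne h1, share]
  by_cases n1 : G (unitStep i) = 1
  · simp [nonOne_of_eq n1, indic, n1]
  · by_cases n2 : G (unitStep i) = 2
    · simp [nonOne_of_ne n1, indic, n2, h2]
      norm_num
    · by_cases n4 : G (unitStep i) = 4 <;> simp [nonOne_of_ne n1, indic, n2, n4, h2, h4]
      norm_num

theorem GridPacking.slack_of_four_ge {G : ℤ × ℤ → ℕ} (hG : GridPacking G) (h : G 0 = 4) :
    18 / 25 * badDegree G + 7 / 25 * nbrCount 2 G - loadTwo G / 4 -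
      ([0, 3, 8, 13, 20].getD (badDegree G) 0 : ℕ) / 9 - loadSix G / 16 ≤ slack G := by
  rw [slack, capacity_of_four h, hG.loadFour_eq_zero (v := 0) (by decide) h,
    ownSix_eq_zero (by omega)]
  linarith [hG.ownFour_le]

theorem GridPacking.slack_of_six_ge {G : ℤ × ℤ → ℕ} (hG : GridPacking G) (h : G 0 = 6) :
    badDegree G / 2 + nbrCount 2 G / 2 - 11 / 50 * nbrCount 4 G - loadTwo G / 4 -
      ([0, 3, 10, 17, 28].getD (badDegree G) 0 : ℕ) / 16 - loadFour G / 9 ≤ slack G := by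
  rw [slack, capacity_of_ne (by omega) (by omega) (by omega),
    hG.loadSix_eq_zero (v := 0) (by decide) h, ownFour_eq_zero (by omega)]
  linarith [ownSix_le G]

theorem slack_of_other {G : ℤ × ℤ → ℕ} (h1 : G 0 ≠ 1) (h2 : G 0 ≠ 2) (h4 : G 0 ≠ 4)
    (h6 : G 0 ≠ 6) :
    slack G = badDegree G / 2 + nbrCount 2 G / 2 - 11 / 50 * nbrCount 4 G - loadTwo G / 4 -
      loadFour G / 9 - loadSix G / 16 := by
  rw [slack, capacity_of_ne h1 h2 h4, ownFour_eq_zero h4, ownSix_eq_zero h6]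
  ring

/-- Either no neighbor has color `4`, or one has and there is no load from other points of
color `4`. -/
theorem GridPacking.nbrCount_four_cases {G : ℤ × ℤ → ℕ} (hG : GridPacking G) :
    nbrCount 4 G = 0 ∨ (nbrCount 4 G = 1 ∧ 1 ≤ badDegree G ∧ loadFour G = 0) := by
  rcases hG.nbrCount_cases (c := 4) (by norm_num) (by norm_num) with h | ⟨h, i, hi⟩
  · exact Or.inl h
  · exact Or.inr ⟨h, badDegree_pos (i := i) (by omega),
      hG.loadFour_eq_zero (gridNorm_unitStep i).le hi⟩

/-- A check over the number of bad edges. A neighbor of color 4 lowers the capacity of a point of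
another color, but excludes `loadFour`. -/
theorem GridPacking.slack_nonneg {G : ℤ × ℤ → ℕ} (hG : GridPacking G) (h2 : G 0 ≠ 2)
    (hn : ∀ i, G (unitStep i) ≠ 2) : 0 ≤ slack G := by
  by_cases h1 : G 0 = 1
  · exact (slack_of_one h1).ge
  have l2 := loadTwo_eq_zero hn
  have s2 := nbrCount_eq_zero hn
  have l4 := loadFour_le G hG
  have l6 := hG.loadSix_le
  have l60 := hG.loadSix_of_badDegree_eq_zero
  have a4 := hG.nbrCount_four_cases
  have hb := badDegree_le G
  by_cases h4 : G 0 = 4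
  · have := hG.slack_of_four_ge h4
    rw [l2, s2] at this
    generalize badDegree G = b at *
    interval_cases b <;> norm_num at * <;> linarith
  by_cases h6 : G 0 = 6
  · have := hG.slack_of_six_ge h6
    rw [l2, s2] at this
    generalize badDegree G = b at *
    rcases a4 with a4 | ⟨a4, hb1, l40⟩
    · rw [a4] at this
      interval_cases b <;> norm_num at * <;> linarith
    · rw [a4, l40] at this
      interval_cases b <;> norm_num at * <;> linarith
  · rw [slack_of_other h1 h2 h4 h6, l2, s2]
    generalize badDegree G = b at *
    rcases a4 with a4 | ⟨a4, hb1, l40⟩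
    · rw [a4]
      interval_cases b <;> norm_num at * <;> linarith
    · rw [a4, l40]
      interval_cases b <;> norm_num at * <;> linarith

/-! ### Slack of a neighbor of a point of color 2. -/

section Star

variable {G : ℤ × ℤ → ℕ} {j : Fin 4}

/-- If `badDegree G = 1`, the only bad edge leads to the point of color 2; call such a neighbor a
leaf. `loadSix` is left out because its estimate depends on the surroundings. -/
theorem GridPacking.slack_star_four_ge (hG : GridPacking G) (h : G 0 = 4)
    (hj : G (unitStep j) = 2) : (if badDegree G = 1 then -1 / 12 else 1 / 5) ≤
      slack G + loadSix G / 16 := by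
  have l2 := hG.loadTwo_le hj
  have s2 := hG.nbrCount_eq_one (c := 2) (by norm_num) (by norm_num) hj
  have hb := badDegree_le G
  have hb1 : 1 ≤ badDegree G := badDegree_pos (i := j) (by omega)
  have := hG.slack_of_four_ge h
  rw [s2] at this
  generalize badDegree G = b at *
  interval_cases b <;> norm_num at * <;> linarith

theorem GridPacking.slack_star_six_ge (hG : GridPacking G) (h : G 0 = 6)
    (hj : G (unitStep j) = 2) : (if badDegree G = 1 then 1 / 150 else 3 / 100) ≤ slack G ∧
      (nbrCount 4 G = 0 → badDegree G ≠ 1 → 1 / 8 ≤ slack G) := by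
  have l2 := hG.loadTwo_le hj
  have s2 := hG.nbrCount_eq_one (c := 2) (by norm_num) (by norm_num) hj
  have l4 := loadFour_le G hG
  have hb := badDegree_le G
  have hb1 : 1 ≤ badDegree G := badDegree_pos (i := j) (by omega)
  have hleaf : badDegree G = 1 → nbrCount 4 G = 0 := fun hb => nbrCount_eq_zero fun i hi => by
    obtain rfl := eq_of_badDegree_eq_one hb (i := i) (j := j) (by omega) (by omega)
    omega
  have := hG.slack_of_six_ge h
  rw [s2] at this
  have a4 := hG.nbrCount_four_cases
  generalize badDegree G = b at *
  generalize nbrCount 4 G = a at *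
  rcases a4 with rfl | ⟨rfl, -, l40⟩
  · interval_cases b <;> norm_num at * <;> (try constructor) <;> linarith
  · rw [l40] at this
    interval_cases b <;> norm_num at * <;> linarith

theorem GridPacking.slack_star_other_ge (hG : GridPacking G) (h1 : G 0 ≠ 1) (h2 : G 0 ≠ 2)
    (h4 : G 0 ≠ 4) (h6 : G 0 ≠ 6) (hj : G (unitStep j) = 2) :
    (if badDegree G = 1 then 97 / 500 else 13 / 20) ≤ slack G + loadSix G / 16 := by
  have l2 := hG.loadTwo_le hj
  have s2 := hG.nbrCount_eq_one (c := 2) (by norm_num) (by norm_num) hj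
  have l4 := loadFour_le G hG
  have hb := badDegree_le G
  have hb1 : 1 ≤ badDegree G := badDegree_pos (i := j) (by omega)
  have hleaf : badDegree G = 1 → nbrCount 4 G = 0 := fun hb => nbrCount_eq_zero fun i hi => by
    obtain rfl := eq_of_badDegree_eq_one hb (i := i) (j := j) (by omega) (by omega)
    omega
  rw [slack_of_other h1 h2 h4 h6, s2]
  have a4 := hG.nbrCount_four_cases
  generalize badDegree G = b at *
  generalize nbrCount 4 G = a at *
  rcases a4 with rfl | ⟨rfl, -, l40⟩
  · interval_cases b <;> norm_num at * <;> linarith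
  · rw [l40]
    interval_cases b <;> norm_num at * <;> linarith

end Star

/-! ### Pooling a point of color 2 with its neighbors. -/

section Pool

variable {G : ℤ × ℤ → ℕ}

theorem badDegree_recenter_pos (h : G 0 = 2) (i : Fin 4) :
    1 ≤ badDegree (recenter (unitStep i) G) :=
  badDegree_pos (i := i + 2) (by rw [recenter_step_back]; omega)

/-- All neighbors of a leaf except the point of color 2 have color 1, and one of them is adjacent to
`unitStep k`. -/
theorem GridPacking.ne_one_of_leaf (hG : GridPacking G) (h : G 0 = 2) {i k : Fin 4}
    (hb : badDegree (recenter (unitStep i) G) = 1) (hk : k = i + 1 ∨ k = i + 3) :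
    G (unitStep k) ≠ 1 := by
  have hne : k ≠ i + 2 :=
    (by decide : ∀ i k : Fin 4, k = i + 1 ∨ k = i + 3 → k ≠ i + 2) i k hk
  have h1 : G (unitStep i + unitStep k) = 1 := by
    by_contra h1
    exact hne (eq_of_badDegree_eq_one hb h1 (by rw [recenter_step_back]; omega))
  refine hG.ne_one h1 ?_
  rw [add_sub_cancel_right, gridNorm_unitStep]

/-- Bounds for any neighbor, for a non-leaf, and for the case of four bad edges at the center. They
are rounded, and affine in the indicators of colors 4 and 6 so that linear arithmetic can add them
up. -/
theorem GridPacking.slack_nbr_ge (hG : GridPacking G) (h : G 0 = 2) {i : Fin 4}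
    (hi : G (unitStep i) ≠ 1) :
    3 / 500 - 139 / 500 * indic (G (unitStep i) = 4) ≤ slack (recenter (unitStep i) G) ∧
    (badDegree (recenter (unitStep i) G) ≠ 1 →
      49 / 100 - 45 / 100 * indic (G (unitStep i) = 4) - 46 / 100 * indic (G (unitStep i) = 6) ≤
        slack (recenter (unitStep i) G)) ∧
    (badDegree G = 4 →
      97 / 500 - 47 / 100 * indic (G (unitStep i) = 4) - 19 / 100 * indic (G (unitStep i) = 6) ≤
        slack (recenter (unitStep i) G)) := by
  set z := recenter (unitStep i) G with hz
  have hzG : GridPacking z := hG.recentered _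
  have z0 : z 0 = G (unitStep i) := recenter_zero _ _
  have zj : z (unitStep (i + 2)) = 2 := by rw [hz, recenter_step_back, h]
  have b1 : 1 ≤ badDegree z := badDegree_recenter_pos h i
  have l6 := hzG.loadSix_le
  have l6' : badDegree z ≠ 1 → loadSix z / 16 ≤ 5 / 32 := by
    intro hb
    have : (2 : ℝ) ≤ badDegree z := by exact_mod_cast (by omega : 2 ≤ badDegree z)
    linarith
  have l6'' : loadSix z / 16 ≤ 3 / 16 := by
    have : (1 : ℝ) ≤ badDegree z := by exact_mod_cast b1
    linarith
  -- A nonzero `loadSix` at a leaf requires its only bad neighbor, the center, to have a neighbor of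
  -- color 1.
  have leaf : badDegree G = 4 → badDegree z = 1 → loadSix z = 0 := by
    intro hG4 hb
    rcases hzG.loadSix_cases with h0 | ⟨u, e, -, -, he, ⟨k, hk⟩, -⟩
    · exact h0
    · obtain rfl : e = i + 2 := eq_of_badDegree_eq_one hb he (by omega)
      have hk' : G (unitStep k) = 1 := by
        rw [← hk, hz, recenter, unitStep_add_two]
        congr 1
        abel
      have : (Finset.univ.filter fun i => G (unitStep i) ≠ 1).card = (Finset.univ : Finset (Fin 4)).card := hG4
      rw [Finset.card_filter_eq_iff] at this
      exact absurd hk' (this k (Finset.mem_univ k))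
  have hne2 := hG.ne_unitStep (by norm_num) (by norm_num) h i
  rw [← z0] at hi hne2 ⊢
  by_cases h4 : z 0 = 4
  · have hs := hzG.slack_star_four_ge h4 zj
    rw [indic_of h4, indic_not (p := z 0 = 6) (by omega)]
    split_ifs at hs with hb
    · exact ⟨by linarith, fun h => absurd hb h, fun h4 => by linarith⟩
    · have := l6' hb
      exact ⟨by linarith, fun _ => by linarith, fun _ => by linarith⟩
  by_cases h6 : z 0 = 6
  · have hs := (hzG.slack_star_six_ge h6 zj).1
    rw [indic_of h6, indic_not (p := z 0 = 4) (by omega)]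
    split_ifs at hs with hb
    · exact ⟨by linarith, fun h => absurd hb h, fun _ => by linarith⟩
    · exact ⟨by linarith, fun _ => by linarith, fun _ => by linarith⟩
  · have hs := hzG.slack_star_other_ge hi hne2 h4 h6 zj
    rw [indic_not h6, indic_not h4]
    split_ifs at hs with hb
    · exact ⟨by linarith, fun h => absurd hb h, fun h4 => by linarith [leaf h4 hb]⟩
    · have := l6' hb
      exact ⟨by linarith, fun _ => by linarith, fun _ => by linarith⟩

theorem GridPacking.slack_pool_of_badDegree_eq_one (hG : GridPacking G) (h : G 0 = 2)
    (hb : badDegree G = 1) {i : Fin 4} (hi : G (unitStep i) ≠ 1) :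
    0 ≤ slack G + slack (recenter (unitStep i) G) := by
  rw [slack_of_two hG h]
  have l4 := loadFour_le G hG
  have l6 := hG.loadSix_le
  rw [hb] at l4 l6
  push_cast at l4 l6
  have nbr := (hG.slack_nbr_ge h hi).2.1
  set z := recenter (unitStep i) G with hz
  have hzG : GridPacking z := hG.recentered _
  have z0 : z 0 = G (unitStep i) := recenter_zero _ _
  have zj : z (unitStep (i + 2)) = 2 := by rw [hz, recenter_step_back, h]
  have b1 : 1 ≤ badDegree z := badDegree_recenter_pos h i
  have hzb : badDegree z ≠ 1 := fun hzb =>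
    absurd (eq_of_badDegree_eq_one hb hi (hG.ne_one_of_leaf h hzb (Or.inl rfl)))
      ((by decide : ∀ i : Fin 4, i ≠ i + 1) i)
  have b2 : (2 : ℝ) ≤ badDegree z := by exact_mod_cast (by omega : 2 ≤ badDegree z)
  have l6z := hzG.loadSix_le
  have hne2 := hG.ne_unitStep (by norm_num) (by norm_num) h i
  by_cases h4 : G (unitStep i) = 4
  -- A point of color 6 that loads the center is at distance 2 from the neighbor, which then bears
  -- no `loadSix`; only one of the two loads must be paid.
  · have hs := hzG.slack_star_four_ge (z0.trans h4) zj
    rw [if_neg hzb] at hs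
    rw [hG.loadFour_eq_zero (gridNorm_unitStep i).le h4]
    rcases hG.loadSix_cases with h0 | ⟨u, e, hu, hue, he, -, -⟩
    · rw [h0]
      linarith
    · obtain rfl := eq_of_badDegree_eq_one hb hi he
      have : loadSix z = 0 := hzG.loadSix_eq_zero (v := u - unitStep i) hue.le (by
        rw [hz, recenter, add_sub_cancel, hu])
      linarith
  by_cases h6 : G (unitStep i) = 6
  · have hs := hzG.slack_star_six_ge (z0.trans h6) zj
    rw [if_neg hzb] at hs
    rw [hG.loadSix_eq_zero ((gridNorm_unitStep i).le.trans (by norm_num)) h6]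
    rcases hzG.nbrCount_cases (c := 4) (by norm_num) (by norm_num) with ha | ⟨-, k, hk⟩
    · have := hs.2 ha hzb
      linarith
    -- This point of color 4 lies beyond the only bad neighbor, so every direction away from it
    -- leads to color 1 and contributes nothing to `loadFour`.
    · have hk' : G (unitStep i + unitStep k) = 4 := hk
      have hzero : loadFour G = 0 := by
        by_cases hex : ∃ u, gridNorm u = 2 ∧ G u = 2 * 2
        · obtain ⟨u, hu, hc⟩ := hex
          have hn := gridNorm_add_le (unitStep i) (unitStep k)
          have hn' := gridNorm_sub_le u (unitStep i + unitStep k)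
          rw [gridNorm_unitStep, gridNorm_unitStep] at hn
          obtain rfl : u = unitStep i + unitStep k :=
            hG.eq_of_norm_le (by norm_num) (by omega) hc hk'
          rw [loadFour, hG.sphereSum_eq (by norm_num) _ hu hc]
          refine Finset.sum_eq_zero fun l _ => ?_
          by_cases hl : l = i
          · rw [hl, add_sub_cancel_left, gridNorm_unitStep, indic_not (by norm_num), zero_mul]
          · rw [nonOne_of_eq (v := unitStep l)]
            · ring
            · by_contra hl1
              exact hl (eq_of_badDegree_eq_one hb hl1 hi)
        · push Not at hex
          exact sphereSum_eq_zero _ hex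
      linarith [hs.1]
  · have := nbr hzb
    rw [indic_not h4, indic_not h6] at this
    linarith

theorem GridPacking.loadFour_le_mul (hG : GridPacking G) :
    loadFour G ≤ (1 - nbrCount 4 G) * (badDegree G / 2) := by
  rcases hG.nbrCount_cases (c := 4) (by norm_num) (by norm_num) with h | ⟨h, i, hi⟩
  · rw [h, sub_zero, one_mul]
    exact loadFour_le G hG
  · rw [h, hG.loadFour_eq_zero (gridNorm_unitStep i).le hi]
    simp

theorem GridPacking.loadSix_le_mul (hG : GridPacking G) :
    loadSix G ≤ (1 - nbrCount 6 G) * ((7 - badDegree G) / 2) := by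
  rcases hG.nbrCount_cases (c := 6) (by norm_num) (by norm_num) with h | ⟨h, i, hi⟩
  · rw [h, sub_zero, one_mul]
    exact hG.loadSix_le
  · rw [h, hG.loadSix_eq_zero ((gridNorm_unitStep i).le.trans (by norm_num)) hi]
    simp

/-- The slacks of a point of color `2` and of its neighbors have a nonnegative sum. -/
theorem GridPacking.slack_pool_nonneg (hG : GridPacking G) (h : G 0 = 2) :
    0 ≤ slack G + ∑ i, slack (recenter (unitStep i) G) := by
  have hz : ∀ i, G (unitStep i) = 1 → slack (recenter (unitStep i) G) = 0 := fun i hi =>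
    slack_of_one (by rw [recenter_zero, hi])
  by_cases hb1 : badDegree G = 1
  · obtain ⟨i, hi⟩ := Finset.card_eq_one.1 hb1
    have hi1 : G (unitStep i) ≠ 1 := by
      have : i ∈ Finset.univ.filter fun i => G (unitStep i) ≠ 1 := by rw [hi]; simp
      simpa using this
    rw [Finset.sum_eq_single_of_mem i (Finset.mem_univ i)]
    · exact hG.slack_pool_of_badDegree_eq_one h hb1 hi1
    · intro j _ hj
      refine hz j ?_
      by_contra hj1
      exact hj (eq_of_badDegree_eq_one hb1 hj1 hi1)
  by_cases hb0 : badDegree G = 0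
  · have h1 : ∀ i, G (unitStep i) = 1 := by
      intro i
      by_contra hi
      have := badDegree_pos hi
      omega
    have l4 := loadFour_le G hG
    rw [hb0] at l4
    rw [Finset.sum_eq_zero fun i _ => hz i (h1 i), slack_of_two hG h,
      hG.loadSix_of_badDegree_eq_zero hb0]
    norm_num at l4 ⊢
    linarith
  have n4 : nbrCount 4 G ≤ 1 := by
    rcases hG.nbrCount_cases (c := 4) (by norm_num) (by norm_num) with h | h <;> linarith [h]
  have n6 : nbrCount 6 G ≤ 1 := by
    rcases hG.nbrCount_cases (c := 6) (by norm_num) (by norm_num) with h | h <;> linarith [h]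
  have l4 := hG.loadFour_le_mul
  have l6 := hG.loadSix_le_mul
  have b2 : (2 : ℝ) ≤ badDegree G := by exact_mod_cast (by omega : 2 ≤ badDegree G)
  -- Case distinctions become penalties: when the subtracted `nonOne` or `2 * (4 - badDegree G)` is
  -- zero, the bound for non-leaves or for four bad edges applies; otherwise the inequality follows
  -- from the general bound.
  have key : ∀ i, (nonOne G (unitStep i) = 0 ∧ indic (G (unitStep i) = 4) = 0 ∧
      indic (G (unitStep i) = 6) = 0 ∧ slack (recenter (unitStep i) G) = 0) ∨
      (nonOne G (unitStep i) = 1 ∧ 0 ≤ indic (G (unitStep i) = 4) ∧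
        0 ≤ indic (G (unitStep i) = 6) ∧
        3 / 500 - 139 / 500 * indic (G (unitStep i) = 4) ≤ slack (recenter (unitStep i) G) ∧
        49 / 100 - 45 / 100 * indic (G (unitStep i) = 4) - 46 / 100 * indic (G (unitStep i) = 6) -
          nonOne G (unitStep (i + 1)) ≤ slack (recenter (unitStep i) G) ∧
        49 / 100 - 45 / 100 * indic (G (unitStep i) = 4) - 46 / 100 * indic (G (unitStep i) = 6) -
          nonOne G (unitStep (i + 3)) ≤ slack (recenter (unitStep i) G) ∧
        97 / 500 - 47 / 100 * indic (G (unitStep i) = 4) - 19 / 100 * indic (G (unitStep i) = 6) -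
          2 * (4 - badDegree G) ≤ slack (recenter (unitStep i) G)) := by
    intro i
    by_cases hi : G (unitStep i) = 1
    · exact Or.inl ⟨nonOne_of_eq hi, indic_not (by omega), indic_not (by omega), hz i hi⟩
    · have q0 := indic_nonneg (G (unitStep i) = 4)
      have r0 := indic_nonneg (G (unitStep i) = 6)
      obtain ⟨hA, hB, hC⟩ := hG.slack_nbr_ge h hi
      have side : ∀ k, k = i + 1 ∨ k = i + 3 → 49 / 100 - 45 / 100 * indic (G (unitStep i) = 4) -
          46 / 100 * indic (G (unitStep i) = 6) - nonOne G (unitStep k) ≤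
            slack (recenter (unitStep i) G) := by
        intro k hk
        by_cases hk1 : G (unitStep k) = 1
        · rw [nonOne_of_eq hk1, sub_zero]
          exact hB fun hb => hG.ne_one_of_leaf h hb hk hk1
        · rw [nonOne_of_ne hk1]
          linarith
      refine Or.inr ⟨nonOne_of_ne hi, q0, r0, hA, side _ (Or.inl rfl), side _ (Or.inr rfl), ?_⟩
      by_cases h4 : badDegree G = 4
      · rw [h4]
        push_cast
        linarith [hC h4]
      · have := badDegree_le G
        have : (badDegree G : ℝ) ≤ 3 := by exact_mod_cast (by omega : badDegree G ≤ 3)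
        linarith
  have l4 := hG.loadFour_le_mul
  have l6 := hG.loadSix_le_mul
  have k0 := key 0
  have k1 := key 1
  have k2 := key 2
  have k3 := key 3
  rw [slack_of_two hG h]
  rw [← sum_nonOne] at *
  simp only [nbrCount, Fin.sum_univ_four] at *
  clear key hz hb1 hb0 hG h
  simp only [show (0 : Fin 4) + 1 = 1 from rfl, show (0 : Fin 4) + 3 = 3 from rfl,
    show (1 : Fin 4) + 1 = 2 from rfl, show (1 : Fin 4) + 3 = 0 from rfl,
    show (2 : Fin 4) + 1 = 3 from rfl, show (2 : Fin 4) + 3 = 1 from rfl,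
    show (3 : Fin 4) + 1 = 0 from rfl, show (3 : Fin 4) + 3 = 2 from rfl] at k0 k1 k2 k3
  generalize nonOne G (unitStep 0) = n0, nonOne G (unitStep 1) = n1,
    nonOne G (unitStep 2) = n2, nonOne G (unitStep 3) = n3 at *
  generalize slack (recenter (unitStep 0) G) = t0, slack (recenter (unitStep 1) G) = t1,
    slack (recenter (unitStep 2) G) = t2, slack (recenter (unitStep 3) G) = t3 at *
  generalize indic (G (unitStep 0) = 4) = q0, indic (G (unitStep 1) = 4) = q1,
    indic (G (unitStep 2) = 4) = q2, indic (G (unitStep 3) = 4) = q3 at *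
  generalize indic (G (unitStep 0) = 6) = r0, indic (G (unitStep 1) = 6) = r1,
    indic (G (unitStep 2) = 6) = r2, indic (G (unitStep 3) = 6) = r3 at *
  rcases k0 with ⟨rfl, rfl, rfl, rfl⟩ | ⟨rfl, k0⟩ <;>
  rcases k1 with ⟨rfl, rfl, rfl, rfl⟩ | ⟨rfl, k1⟩ <;>
  rcases k2 with ⟨rfl, rfl, rfl, rfl⟩ | ⟨rfl, k2⟩ <;>
  rcases k3 with ⟨rfl, rfl, rfl, rfl⟩ | ⟨rfl, k3⟩ <;>
  linarith

end Pool

/-! ### Test sets of bounded diameter. -/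

theorem card_edgeBall (i : Fin 4) : (edgeBall 1 i).card = 8 ∧ (edgeBall 2 i).card = 18 ∧
    (edgeBall 3 i).card = 32 ∧ (edgeBall 4 i).card = 50 := by
  revert i; decide +kernel

theorem gridNorm_sub_le_of_mem_edgeBall {m : ℕ} {i : Fin 4} {v w : ℤ × ℤ} (hv : v ∈ edgeBall m i)
    (hw : w ∈ edgeBall m i) : gridNorm (v - w) ≤ 2 * m + 1 := by
  have h1 := gridNorm_sub_le v w
  have h2 := gridNorm_sub_le (v - unitStep i) (w - unitStep i)
  have h3 := gridNorm_sub_le (v - unitStep i) w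
  have h4 := gridNorm_sub_le v (w - unitStep i)
  have h5 := gridNorm_add_le (v - unitStep i - w) (unitStep i)
  have h6 := gridNorm_sub_le (v - (w - unitStep i)) (unitStep i)
  rw [sub_sub_sub_cancel_right] at h2
  rw [show v - unitStep i - w + unitStep i = v - w by abel, gridNorm_unitStep] at h5
  rw [show v - (w - unitStep i) - unitStep i = v - w by abel, gridNorm_unitStep] at h6
  rw [mem_edgeBall] at hv hw
  omega

/-- A set of diameter `10` without two points that differ by `(9, -1)`. -/
def smallBall : Finset (ℤ × ℤ) := (gridBall 5).filter fun v => v ≠ (-5, 0) ∧ v ≠ (5, 0)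

/-- A set of diameter `11` without two points that differ by `(9, -1)` or `(10, -1)`. -/
def smallEdgeBall : Finset (ℤ × ℤ) :=
  (edgeBall 5 0).filter fun v => v ≠ (-5, 0) ∧ v ≠ (5, -1) ∧ v ≠ (-4, 1) ∧ v ≠ (6, 0)

theorem card_smallBall : smallBall.card = 59 := by decide +kernel

theorem card_smallEdgeBall : smallEdgeBall.card = 68 := by decide +kernel

/-- The full ball contains exempt pairs such as `(5, 0)` and `(-4, 1)`. Deleting points leaves 59 of
61 here, and 68 of 72 for `smallEdgeBall`. -/
theorem smallBall_spec : ∀ v ∈ smallBall, ∀ w ∈ smallBall, v ≠ w →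
    gridNorm (v - w) ≤ 10 ∧ (v - w).1 + 9 * (v - w).2 ≠ 0 ∧ (v - w).1 + 10 * (v - w).2 ≠ 0 := by
  decide +kernel

theorem smallEdgeBall_spec : ∀ v ∈ smallEdgeBall, ∀ w ∈ smallEdgeBall, v ≠ w →
    gridNorm (v - w) ≤ 11 ∧ (v - w).1 + 9 * (v - w).2 ≠ 0 ∧ (v - w).1 + 10 * (v - w).2 ≠ 0 := by
  decide +kernel

theorem recenter_neg_recenter (v : ℤ × ℤ) (G : ℤ × ℤ → ℕ) : recenter (-v) (recenter v G) = G := by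
  funext w
  simp [recenter]

theorem recenter_recenter_neg (v : ℤ × ℤ) (G : ℤ × ℤ → ℕ) : recenter v (recenter (-v) G) = G := by
  funext w
  simp [recenter]

/-! ### Averaging over a finite quotient. -/

section Average

variable {A : Type*} [AddCommGroup A] [Fintype A] (f : A → ℕ) (ι : ℤ × ℤ →+ A)

/-- The coloring of the grid induced by a coloring of a quotient of the grid, seen from `a`. -/
def gridView (a : A) : ℤ × ℤ → ℕ := fun v => f (a + ι v)

/-- The sum of a functional over all base points. -/
noncomputable def total (Φ : (ℤ × ℤ → ℕ) → ℝ) : ℝ := ∑ a, Φ (gridView f ι a)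

/-- The number of base points of color `c`. -/
noncomputable def colorCount (c : ℕ) : ℝ := total f ι fun G => indic (G 0 = c)

variable {f ι}

theorem total_recenter (v : ℤ × ℤ) (Φ : (ℤ × ℤ → ℕ) → ℝ) :
    total f ι (fun G => Φ (recenter v G)) = total f ι Φ := by
  refine Fintype.sum_equiv (Equiv.addRight (ι v)) _ _ fun a => ?_
  change Φ _ = Φ _
  congr 1
  funext w
  simp [recenter, gridView, add_assoc]

theorem total_sum {κ : Type*} (s : Finset κ) (Φ : κ → (ℤ × ℤ → ℕ) → ℝ) :
    total f ι (fun G => ∑ k ∈ s, Φ k G) = ∑ k ∈ s, total f ι (Φ k) :=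
  Finset.sum_comm

theorem total_add (Φ Ψ : (ℤ × ℤ → ℕ) → ℝ) :
    total f ι (fun G => Φ G + Ψ G) = total f ι Φ + total f ι Ψ :=
  Finset.sum_add_distrib

theorem total_const (r : ℝ) : total f ι (fun _ => r) = Fintype.card A * r := by
  simp [total]

theorem total_mono (hf : ∀ a, GridPacking (gridView f ι a)) {Φ Ψ : (ℤ × ℤ → ℕ) → ℝ}
    (h : ∀ G, GridPacking G → Φ G ≤ Ψ G) : total f ι Φ ≤ total f ι Ψ :=
  Finset.sum_le_sum fun a _ => h _ (hf a)

theorem total_congr (hf : ∀ a, GridPacking (gridView f ι a)) {Φ Ψ : (ℤ × ℤ → ℕ) → ℝ}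
    (h : ∀ G, GridPacking G → Φ G = Ψ G) : total f ι Φ = total f ι Ψ :=
  Finset.sum_congr rfl fun a _ => h _ (hf a)

theorem total_sum_indic (D : Finset (ℤ × ℤ)) (c : ℕ) :
    total f ι (fun G => ∑ v ∈ D, indic (G v = c)) = D.card * colorCount f ι c := by
  rw [total_sum, ← nsmul_eq_mul, ← Finset.sum_const]
  refine Finset.sum_congr rfl fun v _ => ?_
  rw [colorCount, ← total_recenter v fun G => indic (G 0 = c)]
  simp only [recenter_zero]

theorem card_mul_colorCount_le (hf : ∀ a, GridPacking (gridView f ι a)) {c : ℕ} (hc : c ≤ 11)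
    {D : Finset (ℤ × ℤ)} (hD : ∀ v ∈ D, ∀ w ∈ D, v ≠ w → gridNorm (v - w) ≤ c ∧
      (v - w).1 + 9 * (v - w).2 ≠ 0 ∧ (v - w).1 + 10 * (v - w).2 ≠ 0) :
    D.card * colorCount f ι c ≤ Fintype.card A := by
  rw [← total_sum_indic, ← mul_one (Fintype.card A : ℝ), ← total_const (f := f) (ι := ι)]
  refine total_mono hf fun G hG => sum_indic_le_one fun v hv w hw hcv hcw => ?_
  by_contra hne
  obtain ⟨h1, h2, h3⟩ := hD v hv w hw hne
  exact hG.packing c hc v w h1 h2 h3 hcv hcw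

theorem card_mul_colorCount_le_of_le_nine (hf : ∀ a, GridPacking (gridView f ι a)) {c : ℕ}
    (hc : c ≤ 9) {D : Finset (ℤ × ℤ)} (hD : ∀ v ∈ D, ∀ w ∈ D, gridNorm (v - w) ≤ c) :
    D.card * colorCount f ι c ≤ Fintype.card A := by
  rw [← total_sum_indic, ← mul_one (Fintype.card A : ℝ), ← total_const (f := f) (ι := ι)]
  exact total_mono hf fun G hG => sum_indic_le_one fun v hv w hw hcv hcw =>
    hG.eq_of_norm_le hc (hD v hv w hw) hcv hcw

/-- The number of ordered pairs of adjacent base points whose colors are not `1`. -/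
noncomputable def badPairs (f : A → ℕ) (ι : ℤ × ℤ →+ A) : ℝ :=
  total f ι fun G => ∑ i, nonOne G 0 * nonOne G (unitStep i)

/-- In each direction there are `|A|` edges, and each point of color 1 spoils exactly two of them,
as no edge has both ends of color 1. -/
theorem colorCount_one (hf : ∀ a, GridPacking (gridView f ι a)) :
    8 * colorCount f ι 1 = 4 * Fintype.card A - badPairs f ι := by
  have h1 : ∀ i, total f ι (fun G => nonOne G 0 * nonOne G (unitStep i)) =
      Fintype.card A - 2 * colorCount f ι 1 := by
    intro i
    have h2 : total f ι (fun G => nonOne G 0 * nonOne G (unitStep i) +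
        (indic (G 0 = 1) + indic (recenter (unitStep i) G 0 = 1))) = Fintype.card A * 1 := by
      rw [← total_const (f := f) (ι := ι)]
      refine total_congr hf fun G hG => ?_
      have h := hG.ne_one_unitStep i
      rw [recenter_zero]
      by_cases h0 : G 0 = 1 <;> by_cases h1 : G (unitStep i) = 1 <;> simp_all [indic, nonOne]
    rw [total_add, total_add, total_recenter (unitStep i) fun G => indic (G 0 = 1)] at h2
    rw [colorCount]
    linarith
  rw [badPairs, total_sum, Finset.sum_congr rfl fun i _ => h1 i]
  simp
  ring

theorem share_add_share {a b : ℕ} (h2 : ¬(a = 2 ∧ b = 2)) (h4 : ¬(a = 4 ∧ b = 4)) :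
    share a b + share b a = 1 := by
  unfold share
  split_ifs <;> first | omega | norm_num

theorem two_mul_total_capacity (hf : ∀ a, GridPacking (gridView f ι a)) :
    2 * total f ι capacity = badPairs f ι := by
  set Φ : Fin 4 → (ℤ × ℤ → ℕ) → ℝ := fun i G =>
    nonOne G 0 * nonOne G (unitStep i) * share (G 0) (G (unitStep i)) with hΦ
  have h1 : total f ι capacity = ∑ i, total f ι (Φ i) := total_sum _ _
  have h2 : total f ι capacity = ∑ i, total f ι fun G => Φ (i + 2) (recenter (unitStep i) G) := by
    rw [h1, ← Equiv.sum_comp (Equiv.addRight (2 : Fin 4))]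
    exact Finset.sum_congr rfl fun i _ => (total_recenter _ _).symm
  rw [two_mul]
  nth_rw 1 [h1]
  rw [h2, ← Finset.sum_add_distrib, badPairs, total_sum]
  refine Finset.sum_congr rfl fun i _ => ?_
  rw [← total_add]
  refine total_congr hf fun G hG => ?_
  have hs := share_add_share (a := G 0) (b := G (unitStep i))
    (fun h => hG.ne_unitStep (by norm_num) (by norm_num) h.1 i h.2)
    (fun h => hG.ne_unitStep (by norm_num) (by norm_num) h.1 i h.2)
  simp only [hΦ, recenter_step_back, recenter_zero, nonOne]
  linear_combination indic (G 0 ≠ 1) * indic (G (unitStep i) ≠ 1) * hs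

/-- Sum `sum_edgeBall_le` over all edges in all four directions. Reversing an edge exchanges the two
corrections, so every load occurs twice. -/
theorem total_sphereSum_ge (hf : ∀ a, GridPacking (gridView f ι a)) {m : ℕ} (hm : m ≤ 4) {k : ℕ}
    (hk : ∀ i, (edgeBall m i).card = k) {W : Fin 4 → (ℤ × ℤ → ℕ) → ℝ} (h0 : ∀ i G, 0 ≤ W i G)
    (h1 : ∀ i G, GridPacking G → 1 ≤ W i G + W (i + 2) (recenter (unitStep i) G)) :
    2 * (k * colorCount f ι (2 * m)) ≤
      2 * Fintype.card A + total f ι fun G => sphereSum m G fun i _ => W i G := by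
  set Φ : Fin 4 → (ℤ × ℤ → ℕ) → ℝ := fun i G => ∑ u ∈ behind m i, indic (G u = 2 * m) * W i G
    with hΦ
  have h2 : ∀ i, k * colorCount f ι (2 * m) ≤
      Fintype.card A + total f ι (Φ i) + total f ι (Φ (i + 2)) := by
    intro i
    rw [← hk i, ← total_sum_indic, ← total_recenter (unitStep i) (Φ (i + 2)),
      ← mul_one (Fintype.card A : ℝ), ← total_const (f := f) (ι := ι), ← total_add, ← total_add]
    exact total_mono hf fun G hG => hG.sum_edgeBall_le hm i (h0 _ _) (h0 _ _) (h1 i G hG)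
  have h3 : (total f ι fun G => sphereSum m G fun i _ => W i G) = ∑ i, total f ι (Φ i) :=
    total_sum _ _
  have h4 : ∑ i, total f ι (Φ (i + 2)) = ∑ i, total f ι (Φ i) :=
    Equiv.sum_comp (Equiv.addRight (2 : Fin 4)) fun i => total f ι (Φ i)
  have h5 := Finset.sum_le_sum fun i (_ : i ∈ (Finset.univ : Finset (Fin 4))) => h2 i
  rw [Finset.sum_add_distrib, Finset.sum_add_distrib, h4, ← h3] at h5
  simp only [Finset.sum_const, Finset.card_univ, Fintype.card_fin, nsmul_eq_mul] at h5
  push_cast at h5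
  linarith

/-- The weight at centers of color 1 is moved to the point of color 4, whose edges towards such a
center are bad. -/
theorem total_sphereSum_four : (total f ι fun G => sphereSum 2 G fun i _ => evenWeight i G) =
    total f ι loadFour + total f ι ownFour := by
  have h : total f ι ownFour =
      total f ι fun G => sphereSum 2 G fun _ _ => 1 - nonOne G 0 := by
    unfold ownFour sphereSum
    simp only [total_sum]
    refine Finset.sum_congr rfl fun i _ => Finset.sum_congr rfl fun u _ => ?_
    rw [← total_recenter u]
    simp [recenter, nonOne]
  rw [h, ← total_add]
  congr 1
  funext G
  simp only [loadFour, sphereSum, ← Finset.sum_add_distrib, evenWeight]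
  exact Finset.sum_congr rfl fun i _ => Finset.sum_congr rfl fun u _ => by ring

theorem total_sphereSum_six : (total f ι fun G => sphereSum 3 G fun i _ => oddWeight i G) =
    total f ι loadSix + total f ι ownSix := by
  have h : total f ι ownSix =
      total f ι fun G => sphereSum 3 G fun i u => indic (Blocked G u) * oddWeight i G := by
    unfold ownSix sphereSum
    simp only [total_sum]
    refine Finset.sum_congr rfl fun i _ => Finset.sum_congr rfl fun u _ => ?_
    rw [← total_recenter u]
    simp only [recenter_neg_recenter, recenter_zero]
  rw [h, ← total_add]
  congr 1
  funext G
  simp only [loadSix, sphereSum, ← Finset.sum_add_distrib]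
  exact Finset.sum_congr rfl fun i _ => Finset.sum_congr rfl fun u _ => by ring

/-- Each neighbor of a point of color 2 hands its slack to that point, which is unique. After
summation the two transfer terms cancel. -/
theorem GridPacking.pooled_slack_nonneg {G : ℤ × ℤ → ℕ} (hG : GridPacking G) :
    slack G * nbrCount 2 G ≤
      slack G + indic (G 0 = 2) * ∑ i, slack (recenter (unitStep i) G) := by
  by_cases h2 : G 0 = 2
  · rw [nbrCount_eq_zero (hG.ne_unitStep (by norm_num) (by norm_num) h2), indic_of h2]
    linarith [hG.slack_pool_nonneg h2]
  · rw [indic_not h2, zero_mul, add_zero]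
    by_cases hn : ∃ i, G (unitStep i) = 2
    · obtain ⟨i, hi⟩ := hn
      rw [hG.nbrCount_eq_one (by norm_num) (by norm_num) hi, mul_one]
    · push Not at hn
      rw [nbrCount_eq_zero hn, mul_zero]
      exact hG.slack_nonneg h2 hn

theorem total_slack_nonneg (hf : ∀ a, GridPacking (gridView f ι a)) : 0 ≤ total f ι slack := by
  have h1 := total_mono hf fun G hG => hG.pooled_slack_nonneg
  have h2 : (total f ι fun G => indic (G 0 = 2) * ∑ i, slack (recenter (unitStep i) G)) =
      total f ι fun G => slack G * nbrCount 2 G := by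
    simp only [nbrCount, Finset.mul_sum, total_sum]
    rw [← Equiv.sum_comp (Equiv.addRight (2 : Fin 4)) fun i =>
      total f ι fun G => slack G * indic (G (unitStep i) = 2)]
    refine Finset.sum_congr rfl fun i _ => ?_
    rw [← total_recenter (-unitStep i)]
    simp only [Equiv.coe_addRight, recenter_recenter_neg, recenter_zero, unitStep_add_two]
    congr 1
    funext G
    ring
  rw [total_add, h2] at h1
  linarith

theorem sum_colorCount (hf : ∀ a, GridPacking (gridView f ι a)) :
    ∑ c ∈ Finset.Icc 1 11, colorCount f ι c = Fintype.card A := by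
  rw [← mul_one (Fintype.card A : ℝ), ← total_const (f := f) (ι := ι)]
  simp only [colorCount]
  rw [← total_sum]
  refine total_congr hf fun G hG => ?_
  rw [Finset.sum_eq_single_of_mem (G 0) (Finset.mem_Icc.2 (hG.mem_range 0)) fun c _ hc =>
    indic_not fun h => hc h.symm, indic_of rfl]

/-- No coloring of a finite quotient of the grid induces packing colorings of the grid with eleven
colors. -/
theorem not_forall_gridPacking : ¬∀ a, GridPacking (gridView f ι a) := by
  intro hf
  have hA : (0 : ℝ) < Fintype.card A := by exact_mod_cast Fintype.card_pos
  have hsum := sum_colorCount hf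
  have b1 := colorCount_one hf
  have b2 := total_sphereSum_ge hf (m := 1) (by norm_num) (fun i => (card_edgeBall i).1)
    oddWeight_nonneg fun i G hG => one_le_oddWeight_add hG i
  have b3 := card_mul_colorCount_le_of_le_nine hf (c := 3) (by norm_num)
    (D := edgeBall 1 0) fun v hv w hw => gridNorm_sub_le_of_mem_edgeBall hv hw
  have b4 := total_sphereSum_ge hf (m := 2) (by norm_num) (fun i => (card_edgeBall i).2.1)
    evenWeight_nonneg fun i G hG => one_le_evenWeight_add hG i
  have b5 := card_mul_colorCount_le_of_le_nine hf (c := 5) (by norm_num)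
    (D := edgeBall 2 0) fun v hv w hw => gridNorm_sub_le_of_mem_edgeBall hv hw
  have b6 := total_sphereSum_ge hf (m := 3) (by norm_num) (fun i => (card_edgeBall i).2.2.1)
    oddWeight_nonneg fun i G hG => one_le_oddWeight_add hG i
  have b7 := card_mul_colorCount_le_of_le_nine hf (c := 7) (by norm_num)
    (D := edgeBall 3 0) fun v hv w hw => gridNorm_sub_le_of_mem_edgeBall hv hw
  have b8 := card_mul_colorCount_le_of_le_nine hf (c := 8) (by norm_num)
    (D := gridBall 4) fun v hv w hw => by
      have := gridNorm_sub_le v w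
      rw [mem_gridBall] at hv hw
      omega
  have b9 := card_mul_colorCount_le_of_le_nine hf (c := 9) (by norm_num)
    (D := edgeBall 4 0) fun v hv w hw => gridNorm_sub_le_of_mem_edgeBall hv hw
  have b10 := card_mul_colorCount_le hf (c := 10) (by norm_num) smallBall_spec
  have b11 := card_mul_colorCount_le hf (c := 11) (by norm_num) smallEdgeBall_spec
  have hs := total_slack_nonneg hf
  have hslack : total f ι slack = total f ι capacity - (total f ι loadTwo / 4 +
      total f ι loadFour / 9 + total f ι ownFour / 9 + total f ι loadSix / 16 +
        total f ι ownSix / 16) := by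
    simp only [total, slack, Finset.sum_sub_distrib, Finset.sum_add_distrib, Finset.sum_div]
  have hcap := two_mul_total_capacity hf
  rw [total_sphereSum_four] at b4
  rw [total_sphereSum_six] at b6
  rw [(card_edgeBall 0).1] at b3
  rw [(card_edgeBall 0).2.1] at b5
  rw [(card_edgeBall 0).2.2.1] at b7
  rw [(card_edgeBall 0).2.2.2] at b9
  rw [show (gridBall 4).card = 41 by decide +kernel] at b8
  rw [card_smallBall] at b10
  rw [card_smallEdgeBall] at b11
  simp only [show Finset.Icc 1 11 = ({1, 2, 3, 4, 5, 6, 7, 8, 9, 10, 11} : Finset ℕ) from rfl]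
    at hsum
  norm_num at hsum b1 b2 b3 b4 b5 b6 b7 b8 b9 b10 b11
  change _ ≤ _ + total f ι loadTwo at b2
  -- The numerical core is 1/2 + 2 * (1/8 + 1/18 + 1/32) + 1/41 + 1/50 + 1/59 + 1/68 < 1.
  linarith

end Average

/-! ### From `D(1, t)` to a finite quotient of the grid. -/

theorem edist_add_mul_le {t : ℤ} (ht : 0 < t) {a : ℤ} (ha : |a| ∈ ({1, t} : Set ℤ)) (m : ℤ) (n : ℕ) :
    (distanceGraph {1, t}).edist m (m + n * a) ≤ n := by
  induction n with
  | zero => simp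
  | succ n ih =>
    have hadj : (distanceGraph {1, t}).Adj (m + n * a) (m + (n + 1 : ℕ) * a) := by
      have e : m + n * a - (m + (n + 1 : ℕ) * a) = -a := by push_cast; ring
      refine ⟨fun h => ?_, by rwa [e, abs_neg]⟩
      have : a = 0 := by
        rw [← sub_eq_zero, e] at h
        omega
      rw [this, abs_zero] at ha
      rcases ha with ha | ha
      · exact absurd ha (by norm_num)
      · exact ht.ne ha
    refine (SimpleGraph.edist_triangle (v := m + n * a)).trans ?_
    rw [← SimpleGraph.edist_eq_one_iff_adj] at hadj
    rw [Nat.cast_succ]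
    exact add_le_add ih hadj.le

theorem edist_le_gridNorm {t : ℤ} (ht : 0 < t) (m : ℤ) (v : ℤ × ℤ) :
    (distanceGraph {1, t}).edist m (m + v.1 + t * v.2) ≤ gridNorm v := by
  have key : ∀ (s : ℤ), |s| ∈ ({1, t} : Set ℤ) → ∀ (m x : ℤ),
      (distanceGraph {1, t}).edist m (m + s * x) ≤ x.natAbs := by
    intro s hs m x
    rcases Int.natAbs_eq x with hx | hx
    · have := edist_add_mul_le ht hs m x.natAbs
      rwa [← hx, mul_comm] at this
    · have := edist_add_mul_le ht (a := -s) (by rwa [abs_neg]) m x.natAbs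
      rwa [show (x.natAbs : ℤ) * -s = s * x by rw [mul_neg, ← neg_mul, ← hx, mul_comm]] at this
  have h1 := key 1 (Or.inl (by norm_num)) m v.1
  have h2 := key t (Or.inr (abs_of_pos ht)) (m + v.1) v.2
  rw [one_mul] at h1
  rw [gridNorm]
  push_cast
  exact SimpleGraph.edist_triangle.trans (add_le_add h1 h2)

/-- In a zero, `|y| ≥ 2` would force `|x| ≥ 18`, and `|y| = 1` forces `t = |x| ≤ 10`, leaving only
the excluded cases 9 and 10. -/
theorem add_mul_ne_zero {t x y : ℤ} (ht : 9 ≤ t) (h : x.natAbs + y.natAbs ≤ 11)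
    (h9 : x + 9 * y ≠ 0) (h10 : x + 10 * y ≠ 0) : x + t * y ≠ 0 := by
  intro h0
  have hy : -1 ≤ y ∧ y ≤ 1 := by
    constructor <;> by_contra! hy <;> nlinarith [show -11 ≤ x by omega, show x ≤ 11 by omega]
  obtain ⟨h1, h2⟩ := hy
  interval_cases y <;> omega

/-- A packing coloring of `D(1, t)` with at most eleven colors, read off from a pattern that occurs
twice, induces packing colorings of the grid. -/
theorem exists_forall_gridPacking {t : ℤ} (ht : 9 ≤ t) {f : ℤ → ℕ} {k : ℕ} (hk : k ≤ 11)
    (hf : IsPackingColoring (distanceGraph {1, t}) k f) :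
    ∃ (N : ℕ) (_ : NeZero N) (g : ZMod N → ℕ) (ι : ℤ × ℤ →+ ZMod N),
      ∀ a, GridPacking (gridView g ι a) := by
  have hpack : ∀ c ≤ 11, ∀ (m : ℤ) (v : ℤ × ℤ), gridNorm v ≤ c → v.1 + t * v.2 ≠ 0 → f m = c →
      f (m + v.1 + t * v.2) ≠ c := by
    intro c _ m v hv hne hm hm'
    have hc : c ∈ Set.Icc 1 k := hm ▸ hf.1 m
    have h := hf.2 c hc m hm (m + v.1 + t * v.2) hm' (by omega)
    have h' := (edist_le_gridNorm (by omega : 0 < t) m v).trans (Nat.cast_le.2 hv)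
    exact absurd h (not_lt.2 h')
  have hrange : ∀ m, 1 ≤ f m ∧ f m ≤ 11 := fun m => ⟨(hf.1 m).1, (hf.1 m).2.trans hk⟩
  -- Grid points within distance 11 have images at most `11 * t` apart, so a repeated window of this
  -- length suffices to close the coloring up to a cycle.
  set W : ℕ := (11 * t).toNat with hW
  obtain ⟨i, j, hij, hw⟩ : ∃ i j : ℕ, i < j ∧
      ∀ s : ℕ, s ≤ W → f ((i * (W + 1) : ℕ) + s) = f ((j * (W + 1) : ℕ) + s) := by
    let w : ℕ → Fin (W + 1) → Fin 12 := fun i s =>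
      ⟨f ((i * (W + 1) : ℕ) + (s : ℕ)), by have := (hrange ((i * (W + 1) : ℕ) + (s : ℕ))).2; omega⟩
    obtain ⟨i, j, hne, hw⟩ := Finite.exists_ne_map_eq_of_infinite w
    have hw' : ∀ s : ℕ, s ≤ W → f ((i * (W + 1) : ℕ) + s) = f ((j * (W + 1) : ℕ) + s) := fun s hs =>
      congrArg Fin.val (congrFun hw ⟨s, by omega⟩)
    rcases hne.lt_or_gt with h | h
    · exact ⟨i, j, h, hw'⟩
    · exact ⟨j, i, h, fun s hs => (hw' s hs).symm⟩
  obtain ⟨d, rfl⟩ : ∃ d, j = i + 1 + d := Nat.exists_eq_add_of_lt hij |>.imp fun d h => by omega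
  set N : ℕ := (d + 1) * (W + 1) with hN
  set n : ℤ := ((i * (W + 1) : ℕ) : ℤ) with hn
  have hNW : W < N := by
    rw [hN]
    nlinarith [Nat.zero_le (d * W)]
  have : NeZero N := ⟨by omega⟩
  have hper : ∀ s : ℕ, s ≤ W → f (n + s) = f (n + N + s) := by
    intro s hs
    rw [hw s hs]
    congr 2
    rw [hn, hN]
    push_cast
    ring
  let g : ZMod N → ℕ := fun b => f (n + b.val)
  -- Forward steps of length at most `W` see the original coloring even across the seam, because the
  -- window there repeats.
  have hg : ∀ (b : ZMod N) (s : ℕ), s ≤ W → g (b + s) = f (n + b.val + s) := by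
    intro b s hs
    have hb := ZMod.val_lt b
    change f (n + (b + s).val) = _
    rw [ZMod.val_add, ZMod.val_natCast, Nat.mod_eq_of_lt (by omega : s < N)]
    by_cases hlt : b.val + s < N
    · rw [Nat.mod_eq_of_lt hlt]
      push_cast
      rw [add_assoc]
    · obtain ⟨r, hr⟩ := Nat.exists_eq_add_of_le (not_lt.1 hlt)
      rw [hr, Nat.add_mod_left, Nat.mod_eq_of_lt (by omega), hper r (by omega)]
      congr 1
      have : (b.val : ℤ) + s = N + r := by exact_mod_cast hr
      linarith
  let ι : ℤ × ℤ →+ ZMod N :=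
    { toFun := fun v => ((v.1 + t * v.2 : ℤ) : ZMod N)
      map_zero' := by simp
      map_add' := fun v w => by push_cast [Prod.fst_add, Prod.snd_add]; ring }
  have hforward : ∀ c ≤ 11, ∀ (b : ZMod N) (v : ℤ × ℤ), gridNorm v ≤ c → v.1 + 9 * v.2 ≠ 0 →
      v.1 + 10 * v.2 ≠ 0 → 0 ≤ v.1 + t * v.2 → g b = c → g (b + ι v) ≠ c := by
    intro c hc b v hv h9 h10 h0 hb
    have hv' : v.1.natAbs + v.2.natAbs ≤ 11 := hv.trans hc
    have hle : (v.1 + t * v.2).toNat ≤ W := by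
      have : v.1 + t * v.2 ≤ 11 * t := by
        nlinarith [show v.1 + v.2 ≤ 11 by omega, show v.1 ≤ 11 by omega, show v.2 ≤ 11 by omega]
      omega
    have hcast : ι v = (((v.1 + t * v.2).toNat : ℕ) : ZMod N) := by
      change ((v.1 + t * v.2 : ℤ) : ZMod N) = _
      rw [← Int.cast_natCast, Int.toNat_of_nonneg h0]
    rw [hcast, hg b _ hle, Int.toNat_of_nonneg h0, ← add_assoc]
    exact hpack c hc _ v hv (add_mul_ne_zero ht hv' h9 h10) hb
  refine ⟨N, this, g, ι, fun a => ⟨fun v => hrange _, fun c hc v w hvw h9 h10 hv hw' => ?_⟩⟩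
  have e1 : a + ι v = a + ι w + ι (v - w) := by rw [map_sub]; abel
  have e2 : a + ι w = a + ι v + ι (w - v) := by rw [map_sub]; abel
  have hv1 : g (a + ι v) = c := hv
  have hw1 : g (a + ι w) = c := hw'
  simp only [Prod.fst_sub, Prod.snd_sub] at h9 h10
  -- Only forward steps are controlled, so the pair is ordered by the sign of the difference of its
  -- images.
  rcases le_total 0 ((v - w).1 + t * (v - w).2) with h | h
  · rw [e1] at hv1
    exact hforward c hc _ (v - w) hvw h9 h10 h hw1 hv1
  · rw [e2] at hw1
    refine hforward c hc _ (w - v) (by rwa [← gridNorm_neg, neg_sub]) ?_ ?_ ?_ hv1 hw1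
    all_goals simp only [Prod.fst_sub, Prod.snd_sub] at h ⊢
    · omega
    · omega
    · linarith

theorem corollary4 (t : ℤ) (ht : 9 ≤ t) :
    12 ≤ packingChromaticNumber (distanceGraph {1, t}) := by
  refine le_iInf₂ fun k ⟨f, hf⟩ => ?_
  by_contra! hk
  have hk' : k < 12 := by exact_mod_cast hk
  obtain ⟨N, _, g, ι, h⟩ := exists_forall_gridPacking ht (by omega) hf
  exact not_forall_gridPacking h
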